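/- **Logic.** Fix a finite set $P$ of unary symbols. $\mathrm{FO}^2_{\mathrm{MOD}}[\downarrow,\downarrow^+,\rightarrow,\rightarrow^+]$ is first-order logic with the two variables $x,y$, the symbols of $P$, equality, the binary symbols $\downarrow$ (child), $\rightarrow$ (right sibling) and their transitive closures $\downarrow^+,\rightarrow^+$, and the quantifiers $\exists^{\bowtie k,l}y\,\psi$ ("the number of $y$ satisfying $\psi$, reduced modulo $l$, is $\bowtie k$"; $\bowtie\in\{\le,=,\ge\}$, $l\ge 1$, $0\le k<l$). Models are non-empty finite, ordered, unranked trees whose nodes carry arbitrary subsets of $P$. A formula is in normal form if $$\varphi=\forall x\forall y\,\chi\;\wedge\;\bigwedge_{i=1}^{n}\forall x\exists y\,\chi_i\;\wedge\;\bigwedge_{j=1}^{m}\forall x\,\exists^{\bowtie_j k_j,l_j}y\,\psi_j ,$$ with $n,m\ge 1$, $\bowtie_j\in\{\le,\ge\}$, $l_j\ge1$, $0\le k_j<l_j$ and $\chi,\chi_i,\psi_j$ quantifier-free. **Full types.** Let $\boldsymbol\alpha=\{0,1\}^P$ be the set of 1-types, and let $\Theta$ be the set of the ten relative positions of $y$ with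 respect to $x$: equal $\theta_=$; child $\theta_\downarrow$; parent $\theta_\uparrow$; descendant but not child $\theta_{\downarrow\downarrow^+}$; ancestor but not parent $\theta_{\uparrow\uparrow^+}$; right sibling $\theta_\rightarrow$; left sibling $\theta_\leftarrow$; following sibling but not the right sibling $\theta_{\rightrightarrows^+}$; preceding sibling but not the left sibling $\theta_{\leftleftarrows^+}$; and free position $\theta_{\not\sim}$ (distinct and none of the others). On $\{0,1\}\times\mathbb Z_{l_1}\times\dots\times\mathbb Z_{l_m}$ let $\oplus$ be maximum in the first coordinate and addition modulo $l_j$ in the others, let $\vec 0$ be the all-zero tuple and $\vec 1=(1,1\bmod l_1,\dots,1\bmod l_m)$. A function from $\boldsymbol\alpha$ to such tuples is *zero* if it is constantly $\vec 0$, and a *singleton* if it is $\vec1$ at one argument and $\vec0$ elsewhere; $\oplus$ is applied to such functions pointwise. A *full type* assigns to each $\theta\in\Theta$ a function $\overline\alpha(\theta)$ from $\boldsymbol\alpha$ to tuples, such that $\overline\alpha(\theta_=)$ is a singleton; $\overline\alpha(\theta)$ is zero or a singleton for $\theta\in\{\theta_\rightarrow,\theta_\leftarrow,\theta_\uparrow\}$;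 and if $\overline\alpha(\theta_\rightarrow)$, $\overline\alpha(\theta_\downarrow)$, $\overline\alpha(\theta_\leftarrow)$ or $\overline\alpha(\theta_\uparrow)$ is zero, then so is $\overline\alpha(\theta_{\rightrightarrows^+})$, $\overline\alpha(\theta_{\downarrow\downarrow^+})$, $\overline\alpha(\theta_{\leftleftarrows^+})$ or $\overline\alpha(\theta_{\uparrow\uparrow^+})$, respectively. Let $\alpha$ be the 1-type with $\overline\alpha(\theta_=)(\alpha)=\vec1$, and let $\models$ denote entailment over finite trees. The full type $\overline\alpha$ is *$\varphi$-consistent* if 1. $\alpha(x)\wedge\beta(y)\wedge\theta(x,y)\models\chi$ whenever $\overline\alpha(\theta)(\beta)\ne\vec0$; 2. for each $i$ there are $\theta,\beta$ with $\overline\alpha(\theta)(\beta)\neq\vec0$ and $\alpha(x)\wedge\beta(y)\wedge\theta(x,y)\models\chi_i$; 3. for each $j$, the sum of the $\mathbb Z_{l_j}$-components of $\overline\alpha(\theta)(\beta)$ over all $(\theta,\beta)$ with $\alpha(x)\wedge\beta(y)\wedge\theta(x,y)\models\psi_j$, reduced modulo $l_j$, is $\bowtie_j k_j$. Put $\mathfrak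 f(\varphi)=(2l_1\cdots l_m)^{|\Theta|\,|\boldsymbol\alpha|}$, and for a full type $\overline\beta$ write $D(\overline\beta)=\overline\beta(\theta_\downarrow)\oplus\overline\beta(\theta_{\downarrow\downarrow^+})$. **Procedure.** On input $\varphi$ in normal form, guess a full type $\overline\alpha$ of the root, i.e. one for which $\overline\alpha(\theta_\uparrow),\overline\alpha(\theta_\rightarrow),\overline\alpha(\theta_\leftarrow),\overline\alpha(\theta_{\not\sim})$ are zero, and run $\mathrm{Build}(\overline\alpha,1)$. The alternating procedure $\mathrm{Build}(\overline\alpha,\mathrm{Lvl})$ works as follows. * Reject if $\overline\alpha$ is not $\varphi$-consistent or $\mathrm{Lvl}\ge\mathfrak f(\varphi)$; otherwise accept if $\overline\alpha(\theta_\downarrow)$ is zero. * Otherwise guess a degree $\mathrm{Deg}\in[1,\mathfrak f(\varphi)]$ and then the full types of $\mathrm{Deg}$ children from left to right. Keep in memory only the current child $\overline\beta$, the remaining degree, the sums $O_\downarrow$ of the $\overline\beta(\theta_=)$ and $O_{\downarrow\downarrow^+}$ of the $D(\overline\beta)$ over the children guessed so far, and a guessed function $R$ from 1-types to tuples announcing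 the sum of the $D$'s of the children still to come. * Every guessed child $\overline\gamma$ must satisfy $\overline\gamma(\theta_\uparrow)=\overline\alpha(\theta_=)$, $\overline\gamma(\theta_{\uparrow\uparrow^+})=\overline\alpha(\theta_\uparrow)\oplus\overline\alpha(\theta_{\uparrow\uparrow^+})$ and $$\overline\gamma(\theta_{\not\sim})=\overline\alpha(\theta_{\not\sim})\oplus\overline\alpha(\theta_\rightarrow)\oplus\overline\alpha(\theta_{\rightrightarrows^+})\oplus\overline\alpha(\theta_\leftarrow)\oplus\overline\alpha(\theta_{\leftleftarrows^+})\oplus O\oplus R,$$ where $O$ is the value of $O_{\downarrow\downarrow^+}$ before $\overline\gamma$ is added (zero for the leftmost child) and $R$ is the value guessed together with $\overline\gamma$. * For the leftmost child, $\overline\gamma(\theta_\leftarrow)$ must be zero. If $\overline\gamma$ follows $\overline\beta$, then $\overline\gamma(\theta_\leftarrow)=\overline\beta(\theta_=)$, $\overline\gamma(\theta_{\leftleftarrows^+})=\overline\beta(\theta_\leftarrow)\oplus\overline\beta(\theta_{\leftleftarrows^+})$, $\overline\beta(\theta_\rightarrow)=\overline\gamma(\theta_=)$, $\overline\beta(\theta_{\rightrightarrows^+})=\overline\gamma(\theta_\rightarrow)\oplus\overline\gamma(\theta_{\rightrightarrows^+})$,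 and the previous $R$ must equal $D(\overline\gamma)$ $\oplus$ the new $R$. * On every child $\overline\beta$, $\mathrm{Build}(\overline\beta,\mathrm{Lvl}+1)$ is run in parallel (a universal branching: all branches must accept). * After the last child $\overline\beta$, accept if $\overline\beta(\theta_\rightarrow)$ and $R$ are zero, $\overline\alpha(\theta_\downarrow)=O_\downarrow$ and $\overline\alpha(\theta_{\downarrow\downarrow^+})=O_{\downarrow\downarrow^+}$; otherwise reject. All guesses are existential branchings, and the procedure accepts $\varphi$ if its initial configuration is accepting in the usual sense of alternation. **Lemma.** For every normal-form $\mathrm{FO}^2_{\mathrm{MOD}}[\downarrow,\downarrow^+,\rightarrow,\rightarrow^+]$ formula $\varphi$, the procedure accepts $\varphi$ if and only if $\varphi$ is satisfiable over finite trees. -/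

import Mathlib

namespace FO2Mod

/-! ### Finite ordered unranked labelled trees -/

/-- An atomic 1-type over the finite set `P` of unary symbols: the choice, for every unary symbol,
of the atom (`true`) or of its negation (`false`).  In a tree all atoms `x ↓ x`, `x → x`, ... are
false, so they carry no information. -/
abbrev OneType (P : Type*) : Type _ := P → Bool

/-- A finite ordered unranked tree, given by its tree domain.  A node is the sequence of child
indices leading from the root to it; `label` gives the unary predicates that hold at a node. -/
structure FinTree (P : Type*) where
  dom : Finset (List ℕ)
  root_mem : [] ∈ dom
  parent_mem : ∀ (u : List ℕ) (i : ℕ), u ++ [i] ∈ dom → u ∈ dom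
  left_mem : ∀ (u : List ℕ) (i : ℕ), u ++ [i + 1] ∈ dom → u ++ [i] ∈ dom
  label : {v : List ℕ // v ∈ dom} → OneType P

namespace FinTree

variable {P : Type*}

/-- The universe of the tree. -/
abbrev Node (T : FinTree P) : Type := {v : List ℕ // v ∈ T.dom}

/-- `w` is a child of `v`. -/
def Child (T : FinTree P) (v w : T.Node) : Prop := ∃ i : ℕ, w.1 = v.1 ++ [i]

/-- `w` is a (proper) descendant of `v`. -/
def Desc (T : FinTree P) : T.Node → T.Node → Prop := Relation.TransGen T.Child

/-- `w` is the right sibling of `v`. -/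
def NextSib (T : FinTree P) (v w : T.Node) : Prop :=
  ∃ (u : List ℕ) (i : ℕ), v.1 = u ++ [i] ∧ w.1 = u ++ [i + 1]

/-- `w` is a following sibling of `v`. -/
def FollSib (T : FinTree P) : T.Node → T.Node → Prop := Relation.TransGen T.NextSib

end FinTree

/-! ### Two-variable logic with modulo counting quantifiers -/

/-- The two variables. -/
inductive Var where
  | x
  | y
  deriving DecidableEq

/-- The navigational binary symbols: child, descendant, right sibling, following sibling. -/
inductive Nav where
  | child
  | desc
  | next
  | foll

/-- The comparison symbols of modulo counting quantifiers. -/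
inductive Cmp where
  | le
  | eq
  | ge

/-- `a ⋈ b`. -/
def Cmp.Holds : Cmp → ℕ → ℕ → Prop
  | .le, a, b => a ≤ b
  | .eq, a, b => a = b
  | .ge, a, b => b ≤ a

/-- Formulas with the two variables `x`, `y` over the unary symbols `P` and the navigational
symbols.  `exMod c k l v φ` is the modulo counting quantifier `∃^{c k, l} v φ`. -/
inductive Formula (P : Type*) where
  | pred (p : P) (v : Var)
  | nav (r : Nav) (v w : Var)
  | equal (v w : Var)
  | not (φ : Formula P)
  | and (φ ψ : Formula P)
  | or (φ ψ : Formula P)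
  | all (v : Var) (φ : Formula P)
  | ex (v : Var) (φ : Formula P)
  | exMod (c : Cmp) (k l : ℕ) (v : Var) (φ : Formula P)

/-- Interpretation of the navigational symbols in a tree. -/
def Nav.Holds {P : Type*} (T : FinTree P) : Nav → T.Node → T.Node → Prop
  | .child => T.Child
  | .desc => T.Desc
  | .next => T.NextSib
  | .foll => T.FollSib

namespace Formula

variable {P : Type*}

/-- Satisfaction of a formula in a tree under an assignment of nodes to the variables. -/
def Holds (T : FinTree P) : (Var → T.Node) → Formula P → Prop
  | e, pred p v => T.label (e v) p = true
  | e, nav r v w => r.Holds T (e v) (e w)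
  | e, equal v w => e v = e w
  | e, not φ => ¬ Holds T e φ
  | e, and φ ψ => Holds T e φ ∧ Holds T e ψ
  | e, or φ ψ => Holds T e φ ∨ Holds T e ψ
  | e, all v φ => ∀ b : T.Node, Holds T (Function.update e v b) φ
  | e, ex v φ => ∃ b : T.Node, Holds T (Function.update e v b) φ
  | e, exMod c k l v φ =>
      c.Holds (Set.ncard {b : T.Node | Holds T (Function.update e v b) φ} % l) k

/-- The formula contains no quantifier. -/
def IsQuantifierFree : Formula P → Prop
  | pred _ _ => True
  | nav _ _ _ => True
  | equal _ _ => True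
  | not φ => IsQuantifierFree φ
  | and φ ψ => IsQuantifierFree φ ∧ IsQuantifierFree ψ
  | or φ ψ => IsQuantifierFree φ ∧ IsQuantifierFree ψ
  | all _ _ => False
  | ex _ _ => False
  | exMod _ _ _ _ _ => False

/-- `T ⊨ φ[v, w]`: the formula holds when `x` is `v` and `y` is `w`. -/
def HoldsAt (T : FinTree P) (v w : T.Node) (φ : Formula P) : Prop :=
  Holds T (fun z => match z with | .x => v | .y => w) φ

/-- The sentence `φ` is satisfiable over finite trees. -/
def Satisfiable (φ : Formula P) : Prop :=
  ∃ T : FinTree P, ∀ e : Var → T.Node, Holds T e φ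

end Formula

/-- The data of a formula in normal form
`∀x∀y χ ∧ ⋀_{i<n} ∀x∃y χᵢ ∧ ⋀_{j<m} ∀x ∃^{⋈ⱼ kⱼ, lⱼ} y ψⱼ`. -/
structure NormalForm (P : Type*) where
  n : ℕ
  m : ℕ
  n_pos : 0 < n
  m_pos : 0 < m
  chi : Formula P
  chiEx : Fin n → Formula P
  psi : Fin m → Formula P
  cmp : Fin m → Cmp
  k : Fin m → ℕ
  l : Fin m → ℕ
  l_pos : ∀ j, 0 < l j
  k_lt : ∀ j, k j < l j
  cmp_le_or_ge : ∀ j, cmp j = Cmp.le ∨ cmp j = Cmp.ge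
  chi_qf : chi.IsQuantifierFree
  chiEx_qf : ∀ i, (chiEx i).IsQuantifierFree
  psi_qf : ∀ j, (psi j).IsQuantifierFree

/-- The formula described by the data. -/
def NormalForm.toFormula {P : Type*} (φ : NormalForm P) : Formula P :=
  List.foldl Formula.and (.all .x (.all .y φ.chi))
    (List.ofFn (fun i => Formula.all .x (.ex .y (φ.chiEx i))) ++
      List.ofFn (fun j => Formula.all .x (.exMod (φ.cmp j) (φ.k j) (φ.l j) .y (φ.psi j))))

/-! ### Order formulas and full types -/

/-- The ten order formulas describing the relative position of `y` with respect to `x`: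
equality, child, parent, descendant that is not a child, ancestor that is not the parent,
right sibling, left sibling, following sibling that is not the right one, preceding sibling that
is not the left one, free position. -/
inductive OrderFormula where
  | eq
  | down
  | up
  | ddown
  | uup
  | right
  | left
  | rright
  | lleft
  | free
  deriving DecidableEq

instance : Fintype OrderFormula where
  elems := {.eq, .down, .up, .ddown, .uup, .right, .left, .rright, .lleft, .free}
  complete := by intro θ; cases θ <;> decide

/-- `T ⊨ θ[v, w]`. -/
def OrderFormula.Holds {P : Type*} (T : FinTree P) : OrderFormula → T.Node → T.Node → Prop
  | .eq, v, w => v = w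
  | .down, v, w => T.Child v w
  | .up, v, w => T.Child w v
  | .ddown, v, w => T.Desc v w ∧ ¬ T.Child v w
  | .uup, v, w => T.Desc w v ∧ ¬ T.Child w v
  | .right, v, w => T.NextSib v w
  | .left, v, w => T.NextSib w v
  | .rright, v, w => T.FollSib v w ∧ ¬ T.NextSib v w
  | .lleft, v, w => T.FollSib w v ∧ ¬ T.NextSib w v
  | .free, v, w => v ≠ w ∧ ¬ T.Desc v w ∧ ¬ T.Desc w v ∧ ¬ T.FollSib v w ∧ ¬ T.FollSib w v

/-- Elements of `{0,1} × ℤ_{l₁} × ... × ℤ_{lₘ}`. -/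
@[ext]
structure Tuple {m : ℕ} (l : Fin m → ℕ) where
  cut : Bool
  res : (j : Fin m) → ZMod (l j)

namespace Tuple

variable {m : ℕ} {l : Fin m → ℕ}

/-- The tuple of the number `0`. -/
instance : Zero (Tuple l) := ⟨⟨false, fun _ => 0⟩⟩

/-- The tuple of the number `1`. -/
instance : One (Tuple l) := ⟨⟨true, fun _ => 1⟩⟩

/-- The operation `⊕`: maximum on the first component, addition modulo `lⱼ` on the others. -/
instance : Add (Tuple l) := ⟨fun s t => ⟨s.cut || t.cut, fun j => s.res j + t.res j⟩⟩

end Tuple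

/-- Functions from 1-types to tuples; `0` and `+` (that is, `⊕`) are taken pointwise. -/
abbrev Profile (P : Type*) {m : ℕ} (l : Fin m → ℕ) : Type _ := OneType P → Tuple l

/-- The function takes the value `1` at one argument and is zero elsewhere. -/
def Profile.IsSingleton {P : Type*} {m : ℕ} {l : Fin m → ℕ} (f : Profile P l) : Prop :=
  ∃ a, f a = 1 ∧ ∀ b, b ≠ a → f b = 0

/-- `(l₁, ..., lₘ)`-full types over the unary symbols `P`, for trees. -/
structure FullType (P : Type*) {m : ℕ} (l : Fin m → ℕ) where
  at_ : OrderFormula → Profile P l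
  eq_singleton : (at_ .eq).IsSingleton
  right_cases : at_ .right = 0 ∨ (at_ .right).IsSingleton
  up_cases : at_ .up = 0 ∨ (at_ .up).IsSingleton
  left_cases : at_ .left = 0 ∨ (at_ .left).IsSingleton
  rright_zero : at_ .right = 0 → at_ .rright = 0
  ddown_zero : at_ .down = 0 → at_ .ddown = 0
  lleft_zero : at_ .left = 0 → at_ .lleft = 0
  uup_zero : at_ .up = 0 → at_ .uup = 0

/-- `α(x) ∧ β(y) ∧ θ(x,y) ⊨ ψ(x,y)` over finite trees. -/
def Entails {P : Type*} (a b : OneType P) (θ : OrderFormula) (ψ : Formula P) : Prop :=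
  ∀ (T : FinTree P) (v w : T.Node),
    T.label v = a → T.label w = b → θ.Holds T v w → ψ.HoldsAt T v w

section

variable {P : Type*} [Fintype P] [DecidableEq P]

open Classical in
/-- `φ`-consistency of a full type `α`; here `a` is the 1-type with `α(θ₌)(a) = 1`. -/
def FullType.IsConsistent (φ : NormalForm P) (α : FullType P φ.l) : Prop :=
  ∃ a : OneType P, α.at_ .eq a = 1 ∧
    (∀ (θ : OrderFormula) (b : OneType P), α.at_ θ b ≠ 0 → Entails a b θ φ.chi) ∧
    (∀ i : Fin φ.n, ∃ (θ : OrderFormula) (b : OneType P),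
      α.at_ θ b ≠ 0 ∧ Entails a b θ (φ.chiEx i)) ∧
    (∀ j : Fin φ.m, (φ.cmp j).Holds
      ((∑ q : OrderFormula × OneType P with Entails a q.2 q.1 (φ.psi j),
        ((α.at_ q.1 q.2).res j).val) % φ.l j) (φ.k j))

/-- The bound `f(φ) = (2 l₁ ⋯ lₘ)^(|Θ| · |𝛂|)`. -/
def NormalForm.bound (φ : NormalForm P) : ℕ :=
  (2 * ∏ j, φ.l j) ^ (Fintype.card OrderFormula * Fintype.card (OneType P))

end

/-! ### The consistency tests of the procedure -/

section

variable {P : Type*} {m : ℕ} {l : Fin m → ℕ}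

/-- The type is that of a root: there is no parent, no sibling and no node in free position. -/
def FullType.IsRoot (α : FullType P l) : Prop :=
  α.at_ .up = 0 ∧ α.at_ .right = 0 ∧ α.at_ .left = 0 ∧ α.at_ .free = 0

/-- The nodes strictly below a node of type `α`. -/
def FullType.below (α : FullType P l) : Profile P l := α.at_ .down + α.at_ .ddown

/-- The nodes that are in free position to every child of a node of type `α`
because of their position with respect to that node. -/
def FullType.aside (α : FullType P l) : Profile P l :=
  α.at_ .free + α.at_ .right + α.at_ .rright + α.at_ .left + α.at_ .lleft

/-- A node of type `β` can be linked to its parent of type `α`, where `before` and `after`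
summarise the proper descendants of the siblings to the left and to the right of that node. -/
def FullType.LinksToParent (α β : FullType P l) (before after : Profile P l) : Prop :=
  β.at_ .up = α.at_ .eq ∧ β.at_ .uup = α.at_ .up + α.at_ .uup ∧
    β.at_ .free = α.aside + before + after

/-- `γ` can be the type of the right sibling of a node of type `β`. -/
def FullType.LinksToLeft (β γ : FullType P l) : Prop :=
  γ.at_ .left = β.at_ .eq ∧ γ.at_ .lleft = β.at_ .left + β.at_ .lleft ∧
    β.at_ .right = γ.at_ .eq ∧ β.at_ .rright = γ.at_ .right + γ.at_ .rright

end

/-! ### The alternating procedure -/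

section

variable {P : Type*} [Fintype P] [DecidableEq P]

/-- The variables of the subtree-building procedure inside its loop. -/
structure Memory (φ : NormalForm P) where
  /-- the type of the node whose children are guessed -/
  parent : FullType P φ.l
  /-- the level of that node -/
  lvl : ℕ
  /-- the number of children not processed yet, the current one included -/
  deg : ℕ
  /-- the type of the current child -/
  cur : FullType P φ.l
  /-- the 1-types of the children guessed so far -/
  childSum : Profile P φ.l
  /-- the 1-types of the proper descendants of the children guessed so far -/
  descSum : Profile P φ.l
  /-- the announced 1-types of the proper descendants of the children still to be guessed -/
  pending : Profile P φ.l

/-- Configurations of the procedure. -/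
inductive Config (φ : NormalForm P) where
  /-- initial configuration: the type of the root is to be guessed -/
  | start
  /-- call of the subtree-building procedure on a full type and a level -/
  | call (α : FullType P φ.l) (lvl : ℕ)
  /-- the degree is to be guessed -/
  | guessDeg (α : FullType P φ.l) (lvl : ℕ)
  /-- the type of the leftmost child is to be guessed -/
  | guessFirst (α : FullType P φ.l) (lvl deg : ℕ)
  /-- the test of the loop -/
  | loop (s : Memory φ)
  /-- parallel recursive call on the current child, inside the loop -/
  | spawn (s : Memory φ)
  /-- the type of the right sibling of the current child is to be guessed -/
  | guessNext (s : Memory φ)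
  /-- parallel recursive call on the last child -/
  | spawnLast (s : Memory φ)
  /-- the final tests -/
  | final (s : Memory φ)
  | accept
  | reject

/-- The universal configurations; all others are existential. -/
def Config.IsUniversal {φ : NormalForm P} : Config φ → Prop
  | .spawn _ => True
  | .spawnLast _ => True
  | _ => False

/-- The final tests at the end of the list of children: the current child has no right sibling,
nothing announced is left, and the obligations of the parent are met. -/
def Memory.FinalTest {φ : NormalForm P} (s : Memory φ) : Prop :=
  s.cur.at_ .right = 0 ∧ s.pending = 0 ∧
    s.parent.at_ .down = s.childSum ∧ s.parent.at_ .ddown = s.descSum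

/-- The transitions of the procedure. -/
inductive Step (φ : NormalForm P) : Config φ → Config φ → Prop
  | root (α : FullType P φ.l) : α.IsRoot → Step φ .start (.call α 1)
  | inconsistent (α : FullType P φ.l) (lvl : ℕ) :
      ¬ α.IsConsistent φ → Step φ (.call α lvl) .reject
  | tooLong (α : FullType P φ.l) (lvl : ℕ) :
      α.IsConsistent φ → φ.bound ≤ lvl → Step φ (.call α lvl) .reject
  | leaf (α : FullType P φ.l) (lvl : ℕ) :
      α.IsConsistent φ → lvl < φ.bound → α.at_ .down = 0 → Step φ (.call α lvl) .accept
  | inner (α : FullType P φ.l) (lvl : ℕ) :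
      α.IsConsistent φ → lvl < φ.bound → α.at_ .down ≠ 0 →
        Step φ (.call α lvl) (.guessDeg α lvl)
  | degree (α : FullType P φ.l) (lvl d : ℕ) :
      1 ≤ d → d ≤ φ.bound → Step φ (.guessDeg α lvl) (.guessFirst α lvl d)
  | first (α β : FullType P φ.l) (lvl d : ℕ) (after : Profile P φ.l) :
      β.at_ .left = 0 → α.LinksToParent β 0 after →
        Step φ (.guessFirst α lvl d) (.loop ⟨α, lvl, d, β, β.at_ .eq, β.below, after⟩)
  | loopEnter (s : Memory φ) : 1 < s.deg → Step φ (.loop s) (.spawn s)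
  | loopExit (s : Memory φ) : ¬ 1 < s.deg → Step φ (.loop s) (.spawnLast s)
  | spawnCall (s : Memory φ) : Step φ (.spawn s) (.call s.cur (s.lvl + 1))
  | spawnContinue (s : Memory φ) : Step φ (.spawn s) (.guessNext s)
  | next (s : Memory φ) (γ : FullType P φ.l) (after : Profile P φ.l) :
      s.cur.LinksToLeft γ → s.parent.LinksToParent γ s.descSum after →
      s.pending = γ.below + after →
        Step φ (.guessNext s) (.loop ⟨s.parent, s.lvl, s.deg - 1, γ,
          s.childSum + γ.at_ .eq, s.descSum + γ.below, after⟩)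
  | lastCall (s : Memory φ) : Step φ (.spawnLast s) (.call s.cur (s.lvl + 1))
  | lastContinue (s : Memory φ) : Step φ (.spawnLast s) (.final s)
  | finalAccept (s : Memory φ) : s.FinalTest → Step φ (.final s) .accept
  | finalReject (s : Memory φ) : ¬ s.FinalTest → Step φ (.final s) .reject

/-- The alternating acceptance condition. -/
inductive Config.Accepting {φ : NormalForm P} : Config φ → Prop
  | accept : Config.Accepting .accept
  | existential (c d : Config φ) :
      ¬ c.IsUniversal → Step φ c d → Config.Accepting d → Config.Accepting c
  | universal (c : Config φ) :
      c.IsUniversal → (∀ d, Step φ c d → Config.Accepting d) → Config.Accepting c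

/-- The procedure accepts the input `φ`. -/
def ProcedureAccepts (φ : NormalForm P) : Prop :=
  Config.Accepting (Config.start : Config φ)

end

end FO2Mod

namespace FO2Mod

/-! ### Tuples and profiles -/

namespace Tuple

variable {m : ℕ} {l : Fin m → ℕ}

/-! The full type of a node records, for every position and 1-type, whether some node of that 1-type
lies at that position, and how many do modulo each `l j`. The position of two nodes and their
1-types decide every quantifier-free formula (`Formula.holds_congr`), so a node meets the
requirements of `φ` exactly when its full type is consistent (`isConsistent_iff`). Satisfiability
thus asks for a tree in which every node has a consistent full type.

The procedure checks only local conditions, those of `Family` between a node and its list of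
children. `Good` is the least predicate closed under them, with no bound on depth or degree, and the
theorem splits at it.

Trees and good types: the true full types of a tree satisfy the local conditions (`family_typeAt`),
by identities that can be checked for one counted node at a time. Conversely, a good root type
unfolds to a finite tree domain carrying announced full types, whose 1-types serve as labels. The
announced types are then the true ones, because for given 1-types the local conditions have only one
solution (`assignment_unique`): the entries below a node are forced from the leaves upwards, the
sibling entries from the two ends of each list, and the remaining ones from the root downwards.

Good types and the procedure: acceptance gives goodness by induction on acceptance. For the converse
no tree is cut and pasted. Good types lie in the least fixed point of a monotone operator, and on a
finite set the iteration stops after as many rounds as there are elements (`iterate_card_fixed`).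
For full types, of which there are fewer than `φ.bound`, this bounds the depth. For the memories
along a list of children it bounds the degree: such a memory consists of thirteen profiles, but two
entries of the current type are dictated by the parent and the sum of the children follows from the
current type, so ten profiles determine it (`card_invariant_le`). -/

@[simp] theorem cut_zero : (0 : Tuple l).cut = false := rfl
@[simp] theorem cut_one : (1 : Tuple l).cut = true := rfl
@[simp] theorem cut_add (s t : Tuple l) : (s + t).cut = (s.cut || t.cut) := rfl
@[simp] theorem res_zero (j : Fin m) : (0 : Tuple l).res j = 0 := rfl
@[simp] theorem res_one (j : Fin m) : (1 : Tuple l).res j = 1 := rfl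
@[simp] theorem res_add (s t : Tuple l) (j : Fin m) : (s + t).res j = s.res j + t.res j := rfl

instance : AddCommMonoid (Tuple l) where
  add_assoc s t u := by ext <;> simp [Bool.or_assoc, add_assoc]
  zero_add s := by ext <;> simp
  add_zero s := by ext <;> simp
  add_comm s t := by ext <;> simp [Bool.or_comm, add_comm]
  nsmul := nsmulRec

/-- The bit separates the two even when every modulus is 1 and all residues of `1` vanish. -/
theorem one_ne_zero : (1 : Tuple l) ≠ 0 := fun h => by simpa using congrArg cut h

/-- The bits are combined by maximum and cannot cancel, so a sum still shows that a node is present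
when its count is zero modulo every `l j`. -/
theorem cut_sum {ι : Type*} (s : Finset ι) (f : ι → Tuple l) :
    (∑ i ∈ s, f i).cut = true ↔ ∃ i ∈ s, (f i).cut = true := by
  classical
  induction s using Finset.induction_on with
  | empty => simp
  | insert a s ha ih => simp [Finset.sum_insert ha, ih]

theorem res_sum {ι : Type*} (s : Finset ι) (f : ι → Tuple l) (j : Fin m) :
    (∑ i ∈ s, f i).res j = ∑ i ∈ s, (f i).res j := by
  classical
  induction s using Finset.induction_on with
  | empty => simp
  | insert a s ha ih => simp [Finset.sum_insert ha, ih]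

/-- Tuples are pairs of a bit and a family of residues. -/
def equivProd : Tuple l ≃ Bool × ((j : Fin m) → ZMod (l j)) where
  toFun t := (t.cut, t.res)
  invFun p := ⟨p.1, p.2⟩
  left_inv _ := rfl
  right_inv _ := rfl

theorem finite (hl : ∀ j, 0 < l j) : Finite (Tuple l) := by
  have : ∀ j, NeZero (l j) := fun j => ⟨(hl j).ne'⟩
  exact Finite.of_equiv _ equivProd.symm

theorem card_eq : Nat.card (Tuple l) = 2 * ∏ j, l j := by
  rw [Nat.card_congr equivProd, Nat.card_prod, Nat.card_pi]
  simp

end Tuple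

section Profiles

variable {P : Type*} {m : ℕ} {l : Fin m → ℕ}

open Classical in
/-- The profile of one node of 1-type `a`. -/
noncomputable def Profile.single (a : OneType P) : Profile P l := fun b => if b = a then 1 else 0

theorem Profile.isSingleton_single (a : OneType P) :
    (Profile.single a : Profile P l).IsSingleton :=
  ⟨a, by simp [Profile.single], fun b hb => by simp [Profile.single, hb]⟩

theorem Profile.IsSingleton.ne_zero {f : Profile P l} (h : f.IsSingleton) : f ≠ 0 := by
  obtain ⟨a, ha, -⟩ := h
  rintro rfl
  exact Tuple.one_ne_zero ha.symm

theorem Profile.IsSingleton.eq_single {f : Profile P l} (h : f.IsSingleton) {a : OneType P}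
    (ha : f a = 1) : f = Profile.single a := by
  obtain ⟨c, hc, h0⟩ := h
  have hac : a = c := by
    by_contra hne
    exact Tuple.one_ne_zero (ha.symm.trans (h0 a hne))
  subst hac
  funext b
  by_cases hb : b = a
  · subst hb; simp [single, hc]
  · simp [single, hb, h0 b hb]

theorem FullType.ext_at {α β : FullType P l} (h : ∀ θ, α.at_ θ = β.at_ θ) : α = β := by
  have h' : α.at_ = β.at_ := funext h
  cases α; cases β
  simp only at h'
  subst h'
  rfl

end Profiles

section Cardinality

variable {P : Type*} [Fintype P] [DecidableEq P]

omit [DecidableEq P] in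
theorem NormalForm.finite_profile (φ : NormalForm P) : Finite (Profile P φ.l) := by
  have := Tuple.finite φ.l_pos
  exact inferInstanceAs (Finite (OneType P → Tuple φ.l))

theorem NormalForm.finite_fullType (φ : NormalForm P) : Finite (FullType P φ.l) := by
  have := φ.finite_profile
  exact Finite.of_injective (fun α : FullType P φ.l => α.at_)
    fun α β h => FullType.ext_at fun θ => congrFun h θ

/-- This is where the bound comes from: it counts all assignments of profiles to positions, with no
full-type conditions imposed. -/
theorem NormalForm.card_positions (φ : NormalForm P) :
    Nat.card (OrderFormula → Profile P φ.l) = φ.bound := by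
  rw [Nat.card_fun, Nat.card_fun, Tuple.card_eq, ← pow_mul, NormalForm.bound]
  simp only [Nat.card_eq_fintype_card, mul_comm]

/-- The zero assignment is no full type, since its entry at equality is not a singleton. Strictness
matters because a call at level `φ.bound` is rejected. -/
theorem NormalForm.card_fullType_lt (φ : NormalForm P) :
    Nat.card (FullType P φ.l) < φ.bound := by
  have := φ.finite_profile
  have := φ.finite_fullType
  rw [← φ.card_positions]
  cases nonempty_fintype (FullType P φ.l)
  cases nonempty_fintype (OrderFormula → Profile P φ.l)
  rw [Nat.card_eq_fintype_card, Nat.card_eq_fintype_card]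
  refine Fintype.card_lt_of_injective_of_notMem (fun α : FullType P φ.l => α.at_)
    (fun α β h => FullType.ext_at fun θ => congrFun h θ) (b := 0) ?_
  rintro ⟨α, hα⟩
  exact α.eq_singleton.ne_zero (congrFun hα .eq)

end Cardinality

/-! ### Iterating a monotone operator on the subsets of a finite type -/

theorem iterate_le_succ {X : Type*} {F : Set X → Set X} (hF : Monotone F) (n : ℕ) :
    F^[n] ∅ ⊆ F^[n + 1] ∅ := by
  induction n with
  | zero => simp
  | succ n ih =>
    rw [Function.iterate_succ_apply', Function.iterate_succ_apply' F (n + 1)]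
    exact hF ih

/-- The iterates of a monotone operator have reached a fixed point when their number is the
size of the type. -/
theorem iterate_card_fixed {X : Type*} [Finite X] {F : Set X → Set X} (hF : Monotone F) {N : ℕ}
    (hN : Nat.card X ≤ N) : F (F^[N] ∅) = F^[N] ∅ := by
  -- Until it stabilizes, the increasing chain of iterates gains at least one element per round.
  have key : ∀ n, F (F^[n] ∅) = F^[n] ∅ ∨ n + 1 ≤ (F^[n + 1] ∅).ncard := by
    intro n
    induction n with
    | zero =>
      by_cases h : F ∅ = ∅
      · left; simpa using h
      · right
        have := (Set.ncard_pos (Set.toFinite (F ∅))).2 (Set.nonempty_iff_ne_empty.2 h)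
        simpa [Nat.one_le_iff_ne_zero, Nat.pos_iff_ne_zero] using this
    | succ n ih =>
      by_cases h : F (F^[n + 1] ∅) = F^[n + 1] ∅
      · exact Or.inl h
      · right
        rcases ih with ih | ih
        · exfalso; apply h
          rw [Function.iterate_succ_apply', ih, ih]
        · have hss : F^[n + 1] ∅ ⊂ F^[n + 2] ∅ := by
            refine (iterate_le_succ hF (n + 1)).ssubset_of_ne fun he => h ?_
            rw [← Function.iterate_succ_apply' F (n + 1)]
            exact he.symm
          have := Set.ncard_lt_ncard hss (Set.toFinite _)
          change n + 2 ≤ (F^[n + 2] ∅).ncard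
          omega
  rcases key N with h | h
  · exact h
  · exfalso
    have := Set.ncard_le_card (F^[N + 1] ∅)
    omega

/-! ### Families of children -/

section Family

variable {P : Type*} {m : ℕ} {l : Fin m → ℕ}

/-- The full types `β 0, …, β (d - 1)` can be those of the children, from left to right, of a node
of full type `α`. -/
structure Family (α : FullType P l) (d : ℕ) (β : ℕ → FullType P l) : Prop where
  down : α.at_ .down = ∑ i ∈ Finset.range d, (β i).at_ .eq
  ddown : α.at_ .ddown = ∑ i ∈ Finset.range d, (β i).below
  link : ∀ i < d, α.LinksToParent (β i) (∑ t ∈ Finset.range i, (β t).below)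
    (∑ t ∈ Finset.Ico (i + 1) d, (β t).below)
  first : 0 < d → (β 0).at_ .left = 0
  last : ∀ i, i + 1 = d → (β i).at_ .right = 0
  sib : ∀ i, i + 1 < d → (β i).LinksToLeft (β (i + 1))

/-- The part of the memory that changes along the list of children. -/
structure SibState (P : Type*) {m : ℕ} (l : Fin m → ℕ) where
  cur : FullType P l
  childSum : Profile P l
  descSum : Profile P l
  pending : Profile P l

variable (α : FullType P l)

/-- The memory after the leftmost child. -/
def SibState.IsFirst (s : SibState P l) : Prop :=
  s.cur.at_ .left = 0 ∧ α.LinksToParent s.cur 0 s.pending ∧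
    s.childSum = s.cur.at_ .eq ∧ s.descSum = s.cur.below

/-- The step from one child to the next one. -/
def SibState.Next (s t : SibState P l) : Prop :=
  s.cur.LinksToLeft t.cur ∧ α.LinksToParent t.cur s.descSum t.pending ∧
    s.pending = t.cur.below + t.pending ∧
    t.childSum = s.childSum + t.cur.at_ .eq ∧ t.descSum = s.descSum + t.cur.below

/-- The tests after the last child. -/
def SibState.IsLast (s : SibState P l) : Prop :=
  s.cur.at_ .right = 0 ∧ s.pending = 0 ∧
    α.at_ .down = s.childSum ∧ α.at_ .ddown = s.descSum

/-- Invariant of the memory along the list of children. -/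
def SibState.Invariant (s : SibState P l) : Prop :=
  s.cur.at_ .up = α.at_ .eq ∧ s.cur.at_ .uup = α.at_ .up + α.at_ .uup ∧
    s.childSum = s.cur.at_ .eq + (s.cur.at_ .left + s.cur.at_ .lleft)

variable {α}

theorem SibState.IsFirst.invariant {s : SibState P l} (h : s.IsFirst α) : s.Invariant α := by
  obtain ⟨h1, ⟨h2, h3, -⟩, h4, -⟩ := h
  exact ⟨h2, h3, by rw [h4, h1, s.cur.lleft_zero h1, add_zero, add_zero]⟩

/-- The nodes to the left of the new child are its predecessor and the nodes to the left of that
one, so the sibling entries of the current child already contain the running sum of the children. -/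
theorem SibState.Next.invariant {s t : SibState P l} (h : s.Next α t) (hs : s.Invariant α) :
    t.Invariant α := by
  obtain ⟨⟨h1, h2, -, -⟩, ⟨h3, h4, -⟩, -, h5, -⟩ := h
  exact ⟨h3, h4, by rw [h5, hs.2.2, h1, h2, add_comm]⟩

/-- The memory of a run along a family, at the child with index `i`. -/
def SibState.ofFamily (d : ℕ) (β : ℕ → FullType P l) (i : ℕ) : SibState P l where
  cur := β i
  childSum := ∑ t ∈ Finset.range (i + 1), (β t).at_ .eq
  descSum := ∑ t ∈ Finset.range (i + 1), (β t).below
  pending := ∑ t ∈ Finset.Ico (i + 1) d, (β t).below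

theorem Family.isFirst {d : ℕ} {β : ℕ → FullType P l} (h : Family α d β) (hd : 0 < d) :
    (SibState.ofFamily d β 0).IsFirst α := by
  have := h.link 0 hd
  exact ⟨h.first hd, by simpa [SibState.ofFamily] using this, by simp [SibState.ofFamily],
    by simp [SibState.ofFamily]⟩

theorem Family.next {d : ℕ} {β : ℕ → FullType P l} (h : Family α d β) {i : ℕ} (hi : i + 1 < d) :
    (SibState.ofFamily d β i).Next α (SibState.ofFamily d β (i + 1)) :=
  ⟨h.sib i hi, h.link (i + 1) hi, Finset.sum_eq_sum_Ico_succ_bot hi _,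
    Finset.sum_range_succ _ _, Finset.sum_range_succ _ _⟩

theorem Family.isLast {i : ℕ} {β : ℕ → FullType P l} (h : Family α (i + 1) β) :
    (SibState.ofFamily (i + 1) β i).IsLast α :=
  ⟨h.last i rfl, by simp [SibState.ofFamily], h.down, h.ddown⟩

/-- A complete run along a list of children yields a family. -/
theorem Family.of_run {n : ℕ} {st : ℕ → SibState P l} (h0 : (st 0).IsFirst α)
    (hs : ∀ i < n, (st i).Next α (st (i + 1))) (hn : (st n).IsLast α) :
    Family α (n + 1) (fun i => (st i).cur) := by
  have hc : ∀ i ≤ n, (st i).childSum = ∑ t ∈ Finset.range (i + 1), (st t).cur.at_ .eq := by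
    intro i hi
    induction i with
    | zero => simpa using h0.2.2.1
    | succ i ih => rw [Finset.sum_range_succ, ← ih (by omega)]; exact (hs i hi).2.2.2.1
  have hd : ∀ i ≤ n, (st i).descSum = ∑ t ∈ Finset.range (i + 1), (st t).cur.below := by
    intro i hi
    induction i with
    | zero => simpa using h0.2.2.2
    | succ i ih => rw [Finset.sum_range_succ, ← ih (by omega)]; exact (hs i hi).2.2.2.2
  -- The announcements are justified from the right end, where the last one must be zero.
  have hp : ∀ k i, i + k = n →
      (st i).pending = ∑ t ∈ Finset.Ico (i + 1) (n + 1), (st t).cur.below := by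
    intro k
    induction k with
    | zero => rintro i rfl; simpa using hn.2.1
    | succ k ih =>
      intro i hi
      rw [Finset.sum_eq_sum_Ico_succ_bot (by omega), ← ih (i + 1) (by omega)]
      exact (hs i (by omega)).2.2.1
  refine ⟨?_, ?_, ?_, fun _ => h0.1, ?_, ?_⟩
  · rw [← hc n le_rfl]; exact hn.2.2.1
  · rw [← hd n le_rfl]; exact hn.2.2.2
  · intro i hi
    rw [← hp (n - i) i (by omega)]
    cases i with
    | zero => simpa using h0.2.1
    | succ i => rw [← hd i (by omega)]; exact (hs i (by omega)).2.1
  · intro i hi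
    obtain rfl : i = n := by omega
    exact hn.1
  · intro i hi
    exact (hs i (by omega)).1

end Family

/-! ### Realizable full types and the procedure -/

section Procedure

variable {P : Type*} [Fintype P] [DecidableEq P] {φ : NormalForm P}

/-- There is a finite tree of consistent full types with `α` at its root. -/
inductive Good (φ : NormalForm P) : FullType P φ.l → Prop
  | mk (α : FullType P φ.l) (d : ℕ) (β : ℕ → FullType P φ.l) :
      α.IsConsistent φ → Family α d β → (∀ i < d, Good φ (β i)) → Good φ α

/-- The part of the memory that changes along the list of children. -/
def Memory.sib (s : Memory φ) : SibState P φ.l := ⟨s.cur, s.childSum, s.descSum, s.pending⟩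

/-- The run can be completed from the memory `s` with good types. -/
def Completes (φ : NormalForm P) (α : FullType P φ.l) (s : SibState P φ.l) : Prop :=
  ∃ (n : ℕ) (st : ℕ → SibState P φ.l), st 0 = s ∧ (∀ i < n, (st i).Next α (st (i + 1))) ∧
    (st n).IsLast α ∧ ∀ i ≤ n, 0 < i → Good φ (st i).cur

/-- Goodness is demanded only of children after the current one, which the parallel call handles;
prepending a memory therefore needs goodness of `t.cur`. -/
theorem Completes.cons {α : FullType P φ.l} {s t : SibState P φ.l} (h : s.Next α t)
    (ht : Completes φ α t) (hg : Good φ t.cur) : Completes φ α s := by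
  obtain ⟨n, st, h0, hs, hn, hc⟩ := ht
  refine ⟨n + 1, fun i => Nat.casesOn i s st, rfl, ?_, hn, ?_⟩
  · rintro (_ | i) hi
    · simpa [h0] using h
    · exact hs i (by omega)
  · rintro (_ | _ | i) hi h'
    · omega
    · simpa [h0] using hg
    · exact hc (i + 1) (by omega) (by omega)

/-- What acceptance of a configuration says about good types. -/
def Config.Meaning : Config φ → Prop
  | .start => ∃ α : FullType P φ.l, α.IsRoot ∧ Good φ α
  | .call α _ => Good φ α
  | .guessDeg α _ => α.IsConsistent φ → Good φ α
  | .guessFirst α _ _ => α.IsConsistent φ → Good φ α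
  | .loop s => Good φ s.cur ∧ Completes φ s.parent s.sib
  | .spawn s => Good φ s.cur ∧ Completes φ s.parent s.sib
  | .guessNext s => Completes φ s.parent s.sib
  | .spawnLast s => Good φ s.cur ∧ Completes φ s.parent s.sib
  | .final s => Completes φ s.parent s.sib
  | .accept => True
  | .reject => False

/-- The level and degree bounds only cause rejections, so they play no role in this direction. -/
theorem Config.Accepting.meaning {c : Config φ} (h : c.Accepting) : c.Meaning := by
  induction h with
  | accept => trivial
  | existential c d hu hs _ ih =>
    cases hs with
    | root α hα => exact ⟨α, hα, ih⟩
    | inconsistent => exact ih.elim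
    | tooLong => exact ih.elim
    | leaf α lvl hc _ h0 =>
      -- A leaf has the empty family; `ddown_zero` supplies the vanishing of the deeper descendants.
      refine Good.mk α 0 (fun _ => α) hc ⟨by simpa using h0, ?_, ?_, ?_, ?_, ?_⟩ ?_
      · simpa using α.ddown_zero h0
      all_goals intros; omega
    | inner α lvl hc => exact ih hc
    | degree => exact ih
    | first α β lvl d after h0 hl =>
      intro hc
      obtain ⟨hg, n, st, hst0, hs, hn, hgood⟩ := ih
      refine Good.mk α (n + 1) (fun i => (st i).cur) hc (Family.of_run ?_ hs hn) ?_
      · rw [hst0]; exact ⟨h0, hl, rfl, rfl⟩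
      · rintro (_ | i) hi
        · rw [hst0]; exact hg
        · exact hgood _ (by omega) (by omega)
    | loopEnter => exact ih
    | loopExit => exact ih
    | spawnCall => exact (hu trivial).elim
    | spawnContinue => exact (hu trivial).elim
    | next s γ after h1 h2 h3 =>
      refine Completes.cons ?_ ih.2 ih.1
      exact ⟨h1, h2, h3, rfl, rfl⟩
    | lastCall => exact (hu trivial).elim
    | lastContinue => exact (hu trivial).elim
    | finalAccept s hf => exact ⟨0, fun _ => s.sib, rfl, by simp, hf, by intros; omega⟩
    | finalReject => exact ih.elim
  | universal c hu _ ih =>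
    cases c with
    | spawn s => exact ⟨ih _ (.spawnCall s), ih _ (.spawnContinue s)⟩
    | spawnLast s => exact ⟨ih _ (.lastCall s), ih _ (.lastContinue s)⟩
    | _ => exact hu.elim

/-! ### Short runs -/

/-- One more child in front of the runs that can be completed. -/
def sibOperator (φ : NormalForm P) (α : FullType P φ.l) (S : Set (FullType P φ.l))
    (X : Set {s : SibState P φ.l // s.Invariant α}) :
    Set {s : SibState P φ.l // s.Invariant α} :=
  {s | s.1.cur ∈ S ∧ (s.1.IsLast α ∨ ∃ t ∈ X, s.1.Next α t.1)}

omit [Fintype P] [DecidableEq P] in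
theorem sibOperator_mono (α : FullType P φ.l) (S : Set (FullType P φ.l)) :
    Monotone (sibOperator φ α S) := by
  rintro X Y hXY s ⟨h1, h2⟩
  exact ⟨h1, h2.imp_right fun ⟨t, ht, h⟩ => ⟨t, hXY ht, h⟩⟩

/-- A memory that satisfies the invariant is determined by ten profiles. -/
def SibState.code {m : ℕ} {l : Fin m → ℕ} (s : SibState P l) (θ : OrderFormula) : Profile P l :=
  if θ = .up then s.descSum else if θ = .uup then s.pending else s.cur.at_ θ

-- By the invariant, the entries of the current type at `up` and `uup` are fixed by `α`, and
-- `childSum` follows from those at `eq`, `left` and `lleft`. The two redundant slots are free to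
-- store `descSum` and `pending`.
omit [Fintype P] [DecidableEq P] in
theorem SibState.code_injective (α : FullType P φ.l) :
    Function.Injective fun s : {s : SibState P φ.l // s.Invariant α} => s.1.code := by
  rintro ⟨⟨c, cs, ds, p⟩, h1, h2, h3⟩ ⟨⟨c', cs', ds', p'⟩, h1', h2', h3'⟩ h
  simp only at h1 h2 h3 h1' h2' h3'
  have hθ : ∀ θ, θ ≠ .up → θ ≠ .uup → c.at_ θ = c'.at_ θ := by
    intro θ hu huu
    simpa [code, hu, huu] using congrFun h θ
  have hc : c = c' := by
    apply FullType.ext_at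
    intro θ
    by_cases hu : θ = .up
    · rw [hu, h1, h1']
    by_cases huu : θ = .uup
    · rw [huu, h2, h2']
    exact hθ θ hu huu
  have hd : ds = ds' := by simpa [code] using congrFun h .up
  have hp : p = p' := by simpa [code] using congrFun h .uup
  subst hc hd hp h3 h3'
  rfl

theorem finite_invariant (α : FullType P φ.l) :
    Finite {s : SibState P φ.l // s.Invariant α} := by
  have := φ.finite_profile
  exact Finite.of_injective _ (SibState.code_injective α)

theorem card_invariant_le (α : FullType P φ.l) :
    Nat.card {s : SibState P φ.l // s.Invariant α} ≤ φ.bound := by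
  have := φ.finite_profile
  rw [← φ.card_positions]
  exact Nat.card_le_card_of_injective _ (SibState.code_injective α)

/-- A run with at most `n` children is a run of the loop of the procedure. -/
theorem accepting_loop {α : FullType P φ.l} {S : Set (FullType P φ.l)} {lvl : ℕ}
    (hS : ∀ β ∈ S, (Config.call β (lvl + 1) : Config φ).Accepting) (n : ℕ) :
    ∀ s ∈ (sibOperator φ α S)^[n] ∅, ∃ d, 1 ≤ d ∧ d ≤ n ∧
      (Config.loop ⟨α, lvl, d, s.1.cur, s.1.childSum, s.1.descSum, s.1.pending⟩ :
        Config φ).Accepting := by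
  induction n with
  | zero => intro s hs; exact hs.elim
  | succ n ih =>
    intro s hs
    rw [Function.iterate_succ_apply'] at hs
    obtain ⟨hc, hl | ⟨t, ht, hn⟩⟩ := hs
    · refine ⟨1, le_rfl, by omega, .existential _ _ (fun h => h) (.loopExit _ (by simp)) ?_⟩
      refine .universal _ trivial fun d hd => ?_
      cases hd with
      | lastCall => exact hS _ hc
      | lastContinue =>
        exact .existential _ _ (fun h => h) (.finalAccept _ hl) .accept
    -- The degree counts down, so the run starting one child earlier needs `d + 1`.
    · obtain ⟨d, hd1, hdn, hacc⟩ := ih t ht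
      refine ⟨d + 1, by omega, by omega,
        .existential _ _ (fun h => h) (.loopEnter _ (by simp only; omega)) ?_⟩
      refine .universal _ trivial fun e he => ?_
      cases he with
      | spawnCall => exact hS _ hc
      | spawnContinue =>
        obtain ⟨h1, h2, h3, h4, h5⟩ := hn
        refine .existential _ _ (fun h => h) (.next _ t.1.cur t.1.pending h1 h2 h3) ?_
        rw [h4, h5] at hacc
        exact hacc

/-- The given family may be longer than the bound. Its memories lie in the fixed point reached after
`φ.bound` rounds, so a run with at most that many children starts from the same first memory and
still uses only types from `S`. -/
theorem accepting_guessDeg {α : FullType P φ.l} {S : Set (FullType P φ.l)} {lvl d : ℕ}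
    {β : ℕ → FullType P φ.l} (hf : Family α d β) (hd : 0 < d) (hβ : ∀ i < d, β i ∈ S)
    (hS : ∀ β ∈ S, (Config.call β (lvl + 1) : Config φ).Accepting) :
    (Config.guessDeg α lvl : Config φ).Accepting := by
  have := finite_invariant α
  have hfix := iterate_card_fixed (sibOperator_mono α S) (card_invariant_le α)
  have hinv : ∀ i < d, (SibState.ofFamily d β i).Invariant α := by
    intro i
    induction i with
    | zero => intro hi; exact (hf.isFirst hi).invariant
    | succ i ih => intro hi; exact (hf.next hi).invariant (ih (by omega))
  -- Membership spreads from the last child to the left, each step absorbed by the fixed-point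
  -- equation.
  have hmem : ∀ k i (hi : i < d), i + k + 1 = d →
      (⟨SibState.ofFamily d β i, hinv i hi⟩ : {s : SibState P φ.l // s.Invariant α}) ∈
        (sibOperator φ α S)^[φ.bound] ∅ := by
    intro k
    induction k with
    | zero =>
      rintro i hi rfl
      rw [← hfix]
      exact ⟨hβ i hi, Or.inl hf.isLast⟩
    | succ k ih =>
      intro i hi hik
      rw [← hfix]
      exact ⟨hβ i hi, Or.inr ⟨_, ih (i + 1) (by omega) (by omega), hf.next (by omega)⟩⟩
  obtain ⟨e, he1, heb, hacc⟩ := accepting_loop hS _ _ (hmem (d - 1) 0 hd (by omega))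
  obtain ⟨h1, h2, h3, h4⟩ := hf.isFirst hd
  refine .existential _ _ (fun h => h) (.degree α lvl e he1 heb) ?_
  refine .existential _ _ (fun h => h) (.first α (β 0) lvl e _ h1 h2) ?_
  rw [h3, h4] at hacc
  exact hacc

/-- One more level on top of trees of consistent full types. -/
def levelOperator (φ : NormalForm P) (S : Set (FullType P φ.l)) : Set (FullType P φ.l) :=
  {α | α.IsConsistent φ ∧ ∃ d β, Family α d β ∧ ∀ i < d, β i ∈ S}

theorem levelOperator_mono : Monotone (levelOperator φ) := by
  rintro X Y hXY α ⟨h1, d, β, h2, h3⟩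
  exact ⟨h1, d, β, h2, fun i hi => hXY (h3 i hi)⟩

-- The bit survives even if the number of children is zero modulo every `l j`; hence a node with
-- children never takes the leaf branch.
omit [Fintype P] [DecidableEq P] in
theorem Family.down_ne_zero {α : FullType P φ.l} {d : ℕ} {β : ℕ → FullType P φ.l}
    (h : Family α d β) (hd : 0 < d) : α.at_ .down ≠ 0 := by
  intro h0
  obtain ⟨a, ha, -⟩ := (β 0).eq_singleton
  have h1 : (α.at_ .down a).cut = true := by
    rw [h.down, Finset.sum_apply, Tuple.cut_sum]
    exact ⟨0, by simpa using hd, by rw [ha]; rfl⟩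
  rw [h0] at h1
  simp at h1

/-- Here `n` bounds the height still to be built. Iterate zero is empty, so `n` is positive and
`lvl` lies strictly below the bound. -/
theorem accepting_call (n : ℕ) : ∀ α ∈ (levelOperator φ)^[n] ∅, ∀ lvl, lvl + n ≤ φ.bound →
    (Config.call α lvl : Config φ).Accepting := by
  induction n with
  | zero => intro α hα; exact hα.elim
  | succ n ih =>
    intro α hα lvl hlvl
    rw [Function.iterate_succ_apply'] at hα
    obtain ⟨hc, d, β, hf, hβ⟩ := hα
    rcases Nat.eq_zero_or_pos d with rfl | hd
    · exact .existential _ _ (fun h => h)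
        (.leaf α lvl hc (by omega) (by simpa using hf.down)) .accept
    · refine .existential _ _ (fun h => h)
        (.inner α lvl hc (by omega) (hf.down_ne_zero hd)) ?_
      exact accepting_guessDeg hf hd hβ fun β hβ => ih β hβ _ (by omega)

/-- The procedure accepts if and only if some root type is good. -/
theorem procedureAccepts_iff : ProcedureAccepts φ ↔ ∃ α : FullType P φ.l, α.IsRoot ∧ Good φ α := by
  refine ⟨fun h => h.meaning, ?_⟩
  rintro ⟨α, hr, hg⟩
  have hlt := φ.card_fullType_lt
  have := φ.finite_fullType
  -- One round fewer than the bound suffices, which leaves room for the root to start at level 1.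
  have hfix := iterate_card_fixed (levelOperator_mono (φ := φ)) (N := φ.bound - 1) (by omega)
  have hmem : α ∈ (levelOperator φ)^[φ.bound - 1] ∅ := by
    clear hr
    induction hg with
    | mk α d β hc hf _ ih =>
      rw [← hfix]
      exact ⟨hc, d, β, hf, ih⟩
  exact .existential _ _ (fun h => h) (.root α hr) (accepting_call _ α hmem 1 (by omega))

end Procedure

/-! ### Relative positions of sequences of child indices -/

namespace OrderFormula

/-- The position of sibling number `j` with respect to sibling number `i`. -/
def sib (i j : ℕ) : OrderFormula :=
  if i = j then .eq else if j = i + 1 then .right else if i = j + 1 then .left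
  else if i < j then .rright else .lleft

/-- The position of the second sequence with respect to the first one. -/
def pos : List ℕ → List ℕ → OrderFormula
  | [], [] => .eq
  | [], [_] => .down
  | [], _ :: _ :: _ => .ddown
  | [_], [] => .up
  | _ :: _ :: _, [] => .uup
  | i :: a, j :: b => if i = j then pos a b else if a = [] ∧ b = [] then sib i j else .free

/-- The converse position. -/
def converse : OrderFormula → OrderFormula
  | .eq => .eq
  | .down => .up
  | .up => .down
  | .ddown => .uup
  | .uup => .ddown
  | .right => .left
  | .left => .right
  | .rright => .lleft
  | .lleft => .rright
  | .free => .free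

theorem converse_sib (i j : ℕ) : (sib i j).converse = sib j i := by
  unfold sib
  split_ifs <;> first | rfl | omega

theorem pos_append (u a b : List ℕ) : pos (u ++ a) (u ++ b) = pos a b := by
  induction u with
  | nil => rfl
  | cons i u ih => simp [pos, ih]

@[simp] theorem pos_self (u : List ℕ) : pos u u = .eq := by
  induction u with
  | nil => rfl
  | cons i u ih => simp [pos, ih]

theorem pos_converse (v w : List ℕ) : (pos v w).converse = pos w v := by
  induction v generalizing w with
  | nil => rcases w with _ | ⟨j, _ | ⟨k, s⟩⟩ <;> rfl
  | cons i a ih =>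
    rcases w with _ | ⟨j, b⟩
    · rcases a with _ | ⟨k, s⟩ <;> rfl
    · simp only [pos]
      by_cases h : i = j
      · simp [h, ih]
      · simp only [h, Ne.symm h, if_false, and_comm (a := a = [])]
        split_ifs
        · exact converse_sib i j
        · rfl

/-- Explicit description of the positions other than the free one. -/
def Rel (v w : List ℕ) : OrderFormula → Prop
  | .eq => v = w
  | .down => ∃ i, w = v ++ [i]
  | .up => ∃ i, v = w ++ [i]
  | .ddown => ∃ i j s, w = v ++ i :: j :: s
  | .uup => ∃ i j s, v = w ++ i :: j :: s
  | .right => ∃ u i, v = u ++ [i] ∧ w = u ++ [i + 1]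
  | .left => ∃ u i, w = u ++ [i] ∧ v = u ++ [i + 1]
  | .rright => ∃ u i j, i + 1 < j ∧ v = u ++ [i] ∧ w = u ++ [j]
  | .lleft => ∃ u i j, i + 1 < j ∧ w = u ++ [i] ∧ v = u ++ [j]
  | .free => True

theorem Rel.cons {v w : List ℕ} {θ : OrderFormula} (h : Rel v w θ) (i : ℕ) :
    Rel (i :: v) (i :: w) θ := by
  cases θ <;> simp only [Rel] at h ⊢
  case eq => rw [h]
  case down => obtain ⟨k, rfl⟩ := h; exact ⟨k, rfl⟩
  case up => obtain ⟨k, rfl⟩ := h; exact ⟨k, rfl⟩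
  case ddown => obtain ⟨k, j, s, rfl⟩ := h; exact ⟨k, j, s, rfl⟩
  case uup => obtain ⟨k, j, s, rfl⟩ := h; exact ⟨k, j, s, rfl⟩
  case right => obtain ⟨u, k, rfl, rfl⟩ := h; exact ⟨i :: u, k, rfl, rfl⟩
  case left => obtain ⟨u, k, rfl, rfl⟩ := h; exact ⟨i :: u, k, rfl, rfl⟩
  case rright => obtain ⟨u, k, j, hk, rfl, rfl⟩ := h; exact ⟨i :: u, k, j, hk, rfl, rfl⟩
  case lleft => obtain ⟨u, k, j, hk, rfl, rfl⟩ := h; exact ⟨i :: u, k, j, hk, rfl, rfl⟩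

theorem rel_sib {i j : ℕ} : Rel [i] [j] (sib i j) := by
  unfold sib
  split_ifs with h1 h2 h3 h4
  · subst h1; rfl
  · subst h2; exact ⟨[], i, rfl, rfl⟩
  · subst h3; exact ⟨[], j, rfl, rfl⟩
  · exact ⟨[], i, j, by omega, rfl, rfl⟩
  · exact ⟨[], j, i, by omega, rfl, rfl⟩

theorem rel_pos (v w : List ℕ) : Rel v w (pos v w) := by
  induction v generalizing w with
  | nil =>
    rcases w with _ | ⟨j, _ | ⟨k, s⟩⟩
    · rfl
    · exact ⟨j, rfl⟩
    · exact ⟨j, k, s, rfl⟩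
  | cons i a ih =>
    rcases w with _ | ⟨j, b⟩
    · rcases a with _ | ⟨k, s⟩
      · exact ⟨i, rfl⟩
      · exact ⟨i, k, s, rfl⟩
    · simp only [pos]
      split_ifs with h h'
      · subst h; exact (ih b).cons i
      · obtain ⟨rfl, rfl⟩ := h'
        exact rel_sib
      · trivial

theorem Rel.pos_eq {v w : List ℕ} {θ : OrderFormula} (h : Rel v w θ) (hθ : θ ≠ .free) :
    pos v w = θ := by
  have key : ∀ a : List ℕ, pos v (v ++ a) = pos [] a := fun a => by
    simpa using pos_append v [] a
  have key' : ∀ a : List ℕ, pos (w ++ a) w = pos a [] := fun a => by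
    simpa using pos_append w a []
  cases θ <;> simp only [Rel] at h
  case eq => rw [h, pos_self]
  case down => obtain ⟨k, rfl⟩ := h; rw [key]; rfl
  case up => obtain ⟨k, rfl⟩ := h; rw [key']; rfl
  case ddown => obtain ⟨k, j, s, rfl⟩ := h; rw [key]; rfl
  case uup => obtain ⟨k, j, s, rfl⟩ := h; rw [key']; rfl
  case right => obtain ⟨u, k, rfl, rfl⟩ := h; rw [pos_append]; simp [pos, sib]
  case left =>
    obtain ⟨u, k, rfl, rfl⟩ := h
    rw [pos_append]
    have h1 : k ≠ k + 1 + 1 := by omega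
    simp [pos, sib, h1]
  case rright =>
    obtain ⟨u, k, j, hk, rfl, rfl⟩ := h
    rw [pos_append]
    have h1 : k ≠ j := by omega
    have h2 : j ≠ k + 1 := by omega
    have h3 : k ≠ j + 1 := by omega
    have h4 : k < j := by omega
    simp [pos, sib, h1, h2, h3, h4]
  case lleft =>
    obtain ⟨u, k, j, hk, rfl, rfl⟩ := h
    rw [pos_append]
    have h1 : j ≠ k := by omega
    have h2 : j ≠ k + 1 := by omega
    have h3 : k ≠ j + 1 := by omega
    have h4 : ¬ j < k := by omega
    simp [pos, sib, h1, h2, h3, h4]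
  case free => exact absurd rfl hθ

/-- `Rel` says nothing at the free position, which is why that position is excluded. -/
theorem pos_eq_iff {v w : List ℕ} {θ : OrderFormula} (hθ : θ ≠ .free) :
    pos v w = θ ↔ Rel v w θ :=
  ⟨fun h => h ▸ rel_pos v w, fun h => h.pos_eq hθ⟩

/-- The position of a node outside the proper subtree of a node with respect to the children of
that node. -/
def outside : OrderFormula → OrderFormula
  | .eq => .up
  | .up => .uup
  | .uup => .uup
  | .down => .free
  | .ddown => .free
  | .right => .free
  | .left => .free
  | .rright => .free
  | .lleft => .free
  | .free => .free

theorem sib_ne_down (i j : ℕ) : sib i j ≠ .down ∧ sib i j ≠ .ddown := by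
  unfold sib
  split_ifs <;> simp

theorem outside_sib {i j : ℕ} (h : i ≠ j) : outside (sib i j) = .free := by
  unfold sib
  split_ifs <;> first | rfl | contradiction

/-- A sequence is a proper extension of `u`, or its position with respect to the immediate
extensions of `u` follows from that with respect to `u`. -/
theorem pos_child_cases (u x : List ℕ) :
    (∃ j s, x = u ++ j :: s) ∨
      (pos u x ≠ .down ∧ pos u x ≠ .ddown ∧ ∀ t, pos (u ++ [t]) x = outside (pos u x)) := by
  induction u generalizing x with
  | nil =>
    rcases x with _ | ⟨j, s⟩
    · right; simp [pos, outside]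
    · exact Or.inl ⟨j, s, rfl⟩
  | cons i u ih =>
    rcases x with _ | ⟨j, s⟩
    · right
      rcases u with _ | ⟨k, u⟩ <;> simp [pos, outside]
    · by_cases h : i = j
      · subst h
        rcases ih s with ⟨j, s, rfl⟩ | h
        · exact Or.inl ⟨j, s, rfl⟩
        · right; simpa [pos] using h
      · right
        simp only [List.cons_append, pos, h, if_false]
        split_ifs with h1
        · exact ⟨(sib_ne_down i j).1, (sib_ne_down i j).2, fun t => by simp [outside_sib h]⟩
        · simp [outside]

end OrderFormula

/-! ### Positions in trees -/

namespace FinTree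

open OrderFormula

variable {P : Type*} (T : FinTree P)

theorem mem_of_append {u : List ℕ} (s : List ℕ) (h : u ++ s ∈ T.dom) : u ∈ T.dom := by
  induction s using List.reverseRecOn with
  | nil => simpa using h
  | append_singleton s i ih =>
    rw [← List.append_assoc] at h
    exact ih (T.parent_mem _ _ h)

theorem mem_of_le {u : List ℕ} {i j : ℕ} (hij : i ≤ j) (h : u ++ [j] ∈ T.dom) :
    u ++ [i] ∈ T.dom := by
  induction j, hij using Nat.le_induction with
  | base => exact h
  | succ j _ ih => exact ih (T.left_mem _ _ h)

/-- Prefix closure of the domain supplies the intermediate nodes of the chain. -/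
theorem desc_iff (v w : T.Node) : T.Desc v w ↔ ∃ i s, w.1 = v.1 ++ i :: s := by
  constructor
  · intro h
    induction h with
    | single h => obtain ⟨i, hi⟩ := h; exact ⟨i, [], hi⟩
    | tail _ h ih =>
      obtain ⟨i, s, hs⟩ := ih
      obtain ⟨j, hj⟩ := h
      exact ⟨i, s ++ [j], by rw [hj, hs]; simp⟩
  · rintro ⟨i, s, hs⟩
    induction s using List.reverseRecOn generalizing w with
    | nil => exact .single ⟨i, hs⟩
    | append_singleton s j ih =>
      have hm : v.1 ++ i :: s ∈ T.dom := T.mem_of_append [j] (by simp [← hs])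
      exact .tail (ih ⟨_, hm⟩ rfl) ⟨j, by simp [hs]⟩

theorem follSib_iff (v w : T.Node) :
    T.FollSib v w ↔ ∃ u i j, i < j ∧ v.1 = u ++ [i] ∧ w.1 = u ++ [j] := by
  constructor
  · intro h
    induction h with
    | single h => obtain ⟨u, i, h1, h2⟩ := h; exact ⟨u, i, i + 1, by omega, h1, h2⟩
    | tail _ h ih =>
      obtain ⟨u, i, j, hij, h1, h2⟩ := ih
      obtain ⟨u', k, h3, h4⟩ := h
      rw [h2] at h3
      obtain ⟨rfl, h5⟩ := List.append_inj' h3 rfl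
      obtain rfl : j = k := by simpa using h5
      exact ⟨u, i, j + 1, by omega, h1, h4⟩
  · rintro ⟨u, i, j, hij, h1, h2⟩
    induction j, hij using Nat.le_induction generalizing w with
    | base => exact .single ⟨u, i, h1, h2⟩
    | succ j hj ih =>
      have hm : u ++ [j] ∈ T.dom := T.left_mem _ _ (by simp [← h2])
      exact .tail (ih ⟨_, hm⟩ rfl) ⟨u, j, rfl, h2⟩

theorem child_iff_pos (v w : T.Node) : T.Child v w ↔ pos v.1 w.1 = .down := by
  rw [pos_eq_iff (by simp)]; rfl

theorem nextSib_iff_pos (v w : T.Node) : T.NextSib v w ↔ pos v.1 w.1 = .right := by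
  rw [pos_eq_iff (by simp)]; rfl

theorem desc_iff_pos (v w : T.Node) :
    T.Desc v w ↔ pos v.1 w.1 = .down ∨ pos v.1 w.1 = .ddown := by
  rw [pos_eq_iff (by simp), pos_eq_iff (by simp), desc_iff]
  constructor
  · rintro ⟨i, _ | ⟨j, s⟩, h⟩
    · exact Or.inl ⟨i, h⟩
    · exact Or.inr ⟨i, j, s, h⟩
  · rintro (⟨i, h⟩ | ⟨i, j, s, h⟩)
    · exact ⟨i, [], h⟩
    · exact ⟨i, j :: s, h⟩

theorem follSib_iff_pos (v w : T.Node) :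
    T.FollSib v w ↔ pos v.1 w.1 = .right ∨ pos v.1 w.1 = .rright := by
  rw [pos_eq_iff (by simp), pos_eq_iff (by simp), follSib_iff]
  constructor
  · rintro ⟨u, i, j, hij, h1, h2⟩
    rcases (Nat.succ_le_iff.2 hij).eq_or_lt with h | h
    · exact Or.inl ⟨u, i, h1, by rw [h2, ← h]⟩
    · exact Or.inr ⟨u, i, j, h, h1, h2⟩
  · rintro (⟨u, i, h1, h2⟩ | ⟨u, i, j, hij, h1, h2⟩)
    · exact ⟨u, i, i + 1, by omega, h1, h2⟩
    · exact ⟨u, i, j, by omega, h1, h2⟩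

/-- Each order formula becomes a condition on the single value `pos v.1 w.1`, with reversed pairs
handled by `converse`. In particular exactly one of the ten holds for each pair. -/
theorem holds_iff_pos (θ : OrderFormula) (v w : T.Node) : θ.Holds T v w ↔ pos v.1 w.1 = θ := by
  have heq : v = w ↔ pos v.1 w.1 = .eq := by
    rw [pos_eq_iff (by simp)]; exact Subtype.ext_iff
  have hf := pos_converse v.1 w.1
  cases θ <;>
    simp only [OrderFormula.Holds, child_iff_pos, nextSib_iff_pos, desc_iff_pos,
      follSib_iff_pos, heq, ← hf, ne_eq] <;>
    cases pos v.1 w.1 <;> simp [converse]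

end FinTree

namespace Nav

/-- The positions at which a navigational symbol holds. -/
def atPos : Nav → OrderFormula → Prop
  | .child, θ => θ = .down
  | .desc, θ => θ = .down ∨ θ = .ddown
  | .next, θ => θ = .right
  | .foll, θ => θ = .right ∨ θ = .rright

theorem holds_iff {P : Type*} (T : FinTree P) (r : Nav) (v w : T.Node) :
    r.Holds T v w ↔ r.atPos (OrderFormula.pos v.1 w.1) := by
  cases r
  · exact T.child_iff_pos v w
  · exact T.desc_iff_pos v w
  · exact T.nextSib_iff_pos v w
  · exact T.follSib_iff_pos v w

end Nav

/-! ### Quantifier-free formulas -/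

section QuantifierFree

open OrderFormula

variable {P : Type*}

/-- The position and the 1-types of two nodes determine the quantifier-free formulas. -/
theorem Formula.holds_congr {T T' : FinTree P} {e : Var → T.Node} {e' : Var → T'.Node}
    (hl : ∀ z, T.label (e z) = T'.label (e' z))
    (hp : pos (e .x).1 (e .y).1 = pos (e' .x).1 (e' .y).1) {ψ : Formula P}
    (hψ : ψ.IsQuantifierFree) : Formula.Holds T e ψ ↔ Formula.Holds T' e' ψ := by
  -- Atoms may also use the variables in reverse order or one variable twice.
  have hp' : ∀ z z', pos (e z).1 (e z').1 = pos (e' z).1 (e' z').1 := by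
    intro z z'
    cases z <;> cases z'
    · simp
    · exact hp
    · rw [← pos_converse, hp, pos_converse]
    · simp
  have heq : ∀ (S : FinTree P) (a b : S.Node), a = b ↔ pos a.1 b.1 = .eq := by
    intro S a b
    rw [pos_eq_iff (by simp)]; exact Subtype.ext_iff
  induction ψ with
  | pred p v => simp [Formula.Holds, hl]
  | nav r v w => simp [Formula.Holds, Nav.holds_iff, hp']
  | equal v w => simp [Formula.Holds, heq, hp']
  | not ψ ih => simp [Formula.Holds, ih hψ]
  | and ψ χ ih ih' => simp [Formula.Holds, ih hψ.1, ih' hψ.2]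
  | or ψ χ ih ih' => simp [Formula.Holds, ih hψ.1, ih' hψ.2]
  | all | ex | exMod => exact hψ.elim

/-- The pair `(v, w)` itself realizes the premises, so the entailment is not vacuous; any other
realization agrees with it by `Formula.holds_congr`. -/
theorem holdsAt_iff_entails (T : FinTree P) (v w : T.Node) {ψ : Formula P}
    (hψ : ψ.IsQuantifierFree) :
    ψ.HoldsAt T v w ↔ Entails (T.label v) (T.label w) (pos v.1 w.1) ψ := by
  constructor
  · intro h T' v' w' hv hw hθ
    rw [FinTree.holds_iff_pos] at hθ
    refine (Formula.holds_congr ?_ hθ hψ).2 h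
    rintro (_ | _)
    · exact hv
    · exact hw
  · intro h
    exact h T v w rfl rfl ((T.holds_iff_pos _ v w).2 rfl)

theorem Formula.holds_foldl_and (T : FinTree P) (e : Var → T.Node) (L : List (Formula P))
    (ψ : Formula P) :
    Formula.Holds T e (L.foldl Formula.and ψ) ↔
      Formula.Holds T e ψ ∧ ∀ χ ∈ L, Formula.Holds T e χ := by
  induction L generalizing ψ with
  | nil => simp
  | cons χ L ih => simp [ih, Formula.Holds, and_assoc]

theorem update_x_y {A : Type*} (e : Var → A) (v w : A) :
    Function.update (Function.update e Var.x v) Var.y w =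
      fun z => match z with | .x => v | .y => w := by
  funext z
  cases z <;> rfl

/-- The meaning of a formula in normal form. -/
theorem NormalForm.holds_iff (φ : NormalForm P) (T : FinTree P) (e : Var → T.Node) :
    Formula.Holds T e φ.toFormula ↔
      ∀ v, (∀ w, φ.chi.HoldsAt T v w) ∧ (∀ i, ∃ w, (φ.chiEx i).HoldsAt T v w) ∧
        ∀ j, (φ.cmp j).Holds (Set.ncard {w | (φ.psi j).HoldsAt T v w} % φ.l j) (φ.k j) := by
  rw [NormalForm.toFormula, Formula.holds_foldl_and]
  simp only [List.mem_append, List.mem_ofFn, or_imp, forall_and, forall_exists_index,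
    forall_apply_eq_imp_iff, Formula.Holds, update_x_y]
  constructor
  · rintro ⟨h1, h2, h3⟩
    exact ⟨h1, fun v i => h2 i v, fun v j => h3 j v⟩
  · rintro ⟨h1, h2, h3⟩
    exact ⟨h1, fun i v => h2 v i, fun j v => h3 v j⟩

end QuantifierFree

/-! ### Counting the nodes at a position -/

namespace OrderFormula

/-- Either `x` is a child of `u`, or it lies properly below one child and is free from all the
others, or it is not below `u` at all. Every identity between the positions relative to `u` and to
its children is checked in these three cases. -/
theorem pos_child_trichotomy (u x : List ℕ) :
    (∃ j, x = u ++ [j] ∧ pos u x = .down ∧ ∀ t, pos (u ++ [t]) x = sib t j) ∨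
    (∃ j s θ, x = u ++ j :: s ∧ (θ = .down ∨ θ = .ddown) ∧ pos u x = .ddown ∧
      ∀ t, pos (u ++ [t]) x = if t = j then θ else .free) ∨
    (pos u x ≠ .down ∧ pos u x ≠ .ddown ∧ ∀ t, pos (u ++ [t]) x = outside (pos u x)) := by
  rcases pos_child_cases u x with ⟨j, s, rfl⟩ | h
  · have hu : pos u (u ++ j :: s) = pos [] (j :: s) := by simpa using pos_append u [] (j :: s)
    simp only [pos_append, hu]
    rcases s with _ | ⟨k, _ | ⟨k', s⟩⟩
    · left
      refine ⟨j, rfl, rfl, fun t => ?_⟩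
      by_cases h : t = j <;> simp [pos, h, sib]
    · right; left
      refine ⟨j, [k], .down, rfl, Or.inl rfl, rfl, fun t => ?_⟩
      by_cases h : t = j <;> simp [pos, h]
    · right; left
      refine ⟨j, k :: k' :: s, .ddown, rfl, Or.inr rfl, rfl, fun t => ?_⟩
      by_cases h : t = j <;> simp [pos, h]
  · exact Or.inr (Or.inr h)

theorem sib_eq_eq {i j : ℕ} : sib i j = .eq ↔ i = j := by
  unfold sib; split_ifs <;> simp <;> omega

theorem sib_eq_right {i j : ℕ} : sib i j = .right ↔ j = i + 1 := by
  unfold sib; split_ifs <;> simp <;> omega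

theorem sib_eq_left {i j : ℕ} : sib i j = .left ↔ i = j + 1 := by
  unfold sib; split_ifs <;> simp <;> omega

theorem sib_eq_rright {i j : ℕ} : sib i j = .rright ↔ i + 1 < j := by
  unfold sib; split_ifs <;> simp <;> omega

theorem sib_eq_lleft {i j : ℕ} : sib i j = .lleft ↔ j + 1 < i := by
  unfold sib; split_ifs <;> simp <;> omega

theorem sib_ne_vertical (i j : ℕ) : sib i j ≠ .down ∧ sib i j ≠ .ddown ∧ sib i j ≠ .up ∧
    sib i j ≠ .uup ∧ sib i j ≠ .free := by
  unfold sib; split_ifs <;> simp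

/-! ### Position identities for a single counted node -/

variable {M : Type*} [AddCommMonoid M]

/-- The value `e` if `x` is at position `θ` with respect to `v`, and `0` otherwise. -/
def ind (e : M) (x v : List ℕ) (θ : OrderFormula) : M := if pos v x = θ then e else 0

theorem ind_of_ne {e : M} {x v : List ℕ} {θ : OrderFormula} (h : pos v x ≠ θ) :
    ind e x v θ = 0 := if_neg h

variable {d : ℕ} {u x : List ℕ} (hd : ∀ j s, x = u ++ j :: s → j < d) (e : M)

include hd

theorem ind_down : ind e x u .down = ∑ t ∈ Finset.range d, ind e x (u ++ [t]) .eq := by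
  rcases pos_child_trichotomy u x with ⟨j, hx, h, ht⟩ | ⟨j, s, θ, hx, hθ, h, ht⟩ | ⟨h, h', ht⟩
  · have := hd _ _ hx
    simp [ind, h, ht, sib_eq_eq, this]
  · rw [ind_of_ne (by simp [h]), Finset.sum_eq_zero]
    intro t _
    apply ind_of_ne
    rw [ht]
    rcases hθ with rfl | rfl <;> split_ifs <;> simp
  · rw [ind_of_ne h, Finset.sum_eq_zero]
    intro t _
    apply ind_of_ne
    rw [ht]
    cases pos u x <;> simp [outside]

theorem ind_ddown : ind e x u .ddown =
    ∑ t ∈ Finset.range d, (ind e x (u ++ [t]) .down + ind e x (u ++ [t]) .ddown) := by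
  rcases pos_child_trichotomy u x with ⟨j, hx, h, ht⟩ | ⟨j, s, θ, hx, hθ, h, ht⟩ | ⟨h, h', ht⟩
  · simp [ind, h, ht, sib_ne_vertical]
  · have hj := hd _ _ hx
    have : ∀ t, ind e x (u ++ [t]) .down + ind e x (u ++ [t]) .ddown = if t = j then e else 0 := by
      intro t
      rcases hθ with rfl | rfl <;> by_cases h : t = j <;> simp [ind, ht, h]
    simp [this, hj]
    simp [ind, h]
  · rw [ind_of_ne h', Finset.sum_eq_zero]
    intro t _
    rw [ind_of_ne, ind_of_ne, add_zero] <;> rw [ht] <;> cases pos u x <;> simp [outside]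

/-- A node is free from child `i` when it is free from `u`, a sibling of `u`, or a proper descendant
of another child. The other children themselves are siblings and do not count. -/
theorem ind_free (i : ℕ) : ind e x (u ++ [i]) .free =
    ind e x u .free + ind e x u .right + ind e x u .rright + ind e x u .left + ind e x u .lleft +
      ∑ t ∈ Finset.range i, (ind e x (u ++ [t]) .down + ind e x (u ++ [t]) .ddown) +
      ∑ t ∈ Finset.Ico (i + 1) d, (ind e x (u ++ [t]) .down + ind e x (u ++ [t]) .ddown) := by
  rcases pos_child_trichotomy u x with ⟨j, hx, h, ht⟩ | ⟨j, s, θ, hx, hθ, h, ht⟩ | ⟨h, h', ht⟩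
  · simp [ind, h, ht, sib_ne_vertical]
  · have hj := hd _ _ hx
    have : ∀ t, ind e x (u ++ [t]) .down + ind e x (u ++ [t]) .ddown = if t = j then e else 0 := by
      intro t
      rcases hθ with rfl | rfl <;> by_cases h : t = j <;> simp [ind, ht, h]
    have hf : ind e x (u ++ [i]) .free = if i = j then 0 else e := by
      rcases hθ with rfl | rfl <;> by_cases h : i = j <;> simp [ind, ht, h]
    simp only [this, Finset.sum_ite_eq', Finset.mem_range, Finset.mem_Ico, hf, hj, and_true]
    simp only [ind, h]
    -- A node properly below child `j` is caught by exactly one of the two sums, or by neither if `j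
    -- = i`.
    rcases lt_trichotomy i j with hij | hij | hij
    · have h1 : ¬ j < i := by omega
      have h2 : i + 1 ≤ j := by omega
      simp [hij.ne, h1, h2]
    · simp [hij]
    · have h2 : ¬ i + 1 ≤ j := by omega
      simp [hij.ne', hij, h2]
  · have : ∀ t, ind e x (u ++ [t]) .down + ind e x (u ++ [t]) .ddown = 0 := by
      intro t
      rw [ind_of_ne, ind_of_ne, add_zero] <;> rw [ht] <;> cases pos u x <;> simp [outside]
    simp only [this, Finset.sum_const_zero, add_zero]
    simp only [ind, ht]
    revert h h'
    cases pos u x <;> simp [outside]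

theorem pos_last_child {i : ℕ} (hi : i + 1 = d) : pos (u ++ [i]) x ≠ .right := by
  rcases pos_child_trichotomy u x with ⟨j, hx, h, ht⟩ | ⟨j, s, θ, hx, hθ, h, ht⟩ | ⟨h, h', ht⟩
  · have := hd _ _ hx
    rw [ht, Ne, sib_eq_right]
    omega
  · rw [ht]
    rcases hθ with rfl | rfl <;> split_ifs <;> simp
  · rw [ht]
    cases pos u x <;> simp [outside]

omit hd

theorem pos_first_child : pos (u ++ [0]) x ≠ .left := by
  rcases pos_child_trichotomy u x with ⟨j, hx, h, ht⟩ | ⟨j, s, θ, hx, hθ, h, ht⟩ | ⟨h, h', ht⟩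
  · rw [ht, Ne, sib_eq_left]
    omega
  · rw [ht]
    rcases hθ with rfl | rfl <;> split_ifs <;> simp
  · rw [ht]
    cases pos u x <;> simp [outside]

theorem ind_up (i : ℕ) : ind e x (u ++ [i]) .up = ind e x u .eq := by
  rcases pos_child_trichotomy u x with ⟨j, hx, h, ht⟩ | ⟨j, s, θ, hx, hθ, h, ht⟩ | ⟨h, h', ht⟩
  · simp [ind, h, ht, sib_ne_vertical]
  · rcases hθ with rfl | rfl <;> by_cases hi : i = j <;> simp [ind, ht, h, hi]
  · simp only [ind, ht]
    cases pos u x <;> simp [outside]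

theorem ind_uup (i : ℕ) : ind e x (u ++ [i]) .uup = ind e x u .up + ind e x u .uup := by
  rcases pos_child_trichotomy u x with ⟨j, hx, h, ht⟩ | ⟨j, s, θ, hx, hθ, h, ht⟩ | ⟨h, h', ht⟩
  · simp [ind, h, ht, sib_ne_vertical]
  · rcases hθ with rfl | rfl <;> by_cases hi : i = j <;> simp [ind, ht, h, hi]
  · simp only [ind, ht]
    cases pos u x <;> simp [outside]

theorem ind_left (i : ℕ) : ind e x (u ++ [i + 1]) .left = ind e x (u ++ [i]) .eq := by
  rcases pos_child_trichotomy u x with ⟨j, hx, h, ht⟩ | ⟨j, s, θ, hx, hθ, h, ht⟩ | ⟨h, h', ht⟩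
  · simp [ind, ht, sib_eq_left, sib_eq_eq]
  · rw [ind_of_ne, ind_of_ne] <;> rw [ht] <;> rcases hθ with rfl | rfl <;> split_ifs <;> simp
  · rw [ind_of_ne, ind_of_ne] <;> rw [ht] <;> cases pos u x <;> simp [outside]

theorem ind_right (i : ℕ) : ind e x (u ++ [i]) .right = ind e x (u ++ [i + 1]) .eq := by
  rcases pos_child_trichotomy u x with ⟨j, hx, h, ht⟩ | ⟨j, s, θ, hx, hθ, h, ht⟩ | ⟨h, h', ht⟩
  · simp [ind, ht, sib_eq_right, sib_eq_eq, eq_comm (a := i + 1)]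
  · rw [ind_of_ne, ind_of_ne] <;> rw [ht] <;> rcases hθ with rfl | rfl <;> split_ifs <;> simp
  · rw [ind_of_ne, ind_of_ne] <;> rw [ht] <;> cases pos u x <;> simp [outside]

theorem ind_lleft (i : ℕ) : ind e x (u ++ [i + 1]) .lleft =
    ind e x (u ++ [i]) .left + ind e x (u ++ [i]) .lleft := by
  rcases pos_child_trichotomy u x with ⟨j, hx, h, ht⟩ | ⟨j, s, θ, hx, hθ, h, ht⟩ | ⟨h, h', ht⟩
  · simp only [ind, ht, sib_eq_left, sib_eq_lleft]
    rcases lt_trichotomy i (j + 1) with h | h | h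
    · have h1 : ¬ j + 1 < i := by omega
      have h2 : ¬ j + 1 < i + 1 := by omega
      simp [h.ne, h1, h2]
    · simp [h]
    · have h2 : j + 1 < i + 1 := by omega
      simp [h, h.ne', h2]
  · rw [ind_of_ne, ind_of_ne, ind_of_ne, add_zero] <;> rw [ht] <;>
      rcases hθ with rfl | rfl <;> split_ifs <;> simp
  · rw [ind_of_ne, ind_of_ne, ind_of_ne, add_zero] <;> rw [ht] <;> cases pos u x <;> simp [outside]

theorem ind_rright (i : ℕ) : ind e x (u ++ [i]) .rright =
    ind e x (u ++ [i + 1]) .right + ind e x (u ++ [i + 1]) .rright := by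
  rcases pos_child_trichotomy u x with ⟨j, hx, h, ht⟩ | ⟨j, s, θ, hx, hθ, h, ht⟩ | ⟨h, h', ht⟩
  · simp only [ind, ht, sib_eq_right, sib_eq_rright]
    rcases lt_trichotomy j (i + 2) with h | h | h
    · have h1 : ¬ i + 1 < j := by omega
      have h2 : ¬ i + 1 + 1 < j := by omega
      have h3 : j ≠ i + 1 + 1 := by omega
      simp [h1, h2, h3]
    · simp [h]
    · have h1 : i + 1 < j := by omega
      have h2 : i + 1 + 1 < j := by omega
      have h3 : j ≠ i + 1 + 1 := by omega
      simp [h1, h2, h3]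
  · rw [ind_of_ne, ind_of_ne, ind_of_ne, add_zero] <;> rw [ht] <;>
      rcases hθ with rfl | rfl <;> split_ifs <;> simp
  · rw [ind_of_ne, ind_of_ne, ind_of_ne, add_zero] <;> rw [ht] <;> cases pos u x <;> simp [outside]

end OrderFormula

/-! ### Full types of the nodes of a tree -/

namespace FinTree

open OrderFormula

variable {P : Type*} (T : FinTree P) {m : ℕ} (l : Fin m → ℕ)

/-- The profile of the nodes at position `θ` with respect to `v`. -/
noncomputable def prof (v : List ℕ) (θ : OrderFormula) : Profile P l :=
  ∑ w : T.Node, ind (Profile.single (T.label w) : Profile P l) w.1 v θ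

/-- Finiteness makes some child index absent, and closure to the left makes the least absent one the
degree. -/
theorem exists_degree (u : T.Node) : ∃ d, ∀ i, u.1 ++ [i] ∈ T.dom ↔ i < d := by
  classical
  have hex : ∃ i, u.1 ++ [i] ∉ T.dom := by
    by_contra! h
    have hinj : Function.Injective fun i : ℕ => (⟨u.1 ++ [i], h i⟩ : T.Node) := by
      intro i j hij
      simpa using congrArg Subtype.val hij
    exact not_injective_infinite_finite _ hinj
  refine ⟨Nat.find hex, fun i => ⟨fun hi => ?_, fun hi => by_contra fun h => Nat.find_min hex hi h⟩⟩
  by_contra! hle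
  exact Nat.find_spec hex (T.mem_of_le hle hi)

theorem prof_eq_zero_iff (v : List ℕ) (θ : OrderFormula) :
    T.prof l v θ = 0 ↔ ∀ w : T.Node, pos v w.1 ≠ θ := by
  constructor
  · intro h w hw
    have h1 : (T.prof l v θ (T.label w)).cut = true := by
      rw [prof, Finset.sum_apply, Tuple.cut_sum]
      exact ⟨w, Finset.mem_univ _, by simp [ind, hw, Profile.single]⟩
    rw [h] at h1
    simp at h1
  · intro h
    exact Finset.sum_eq_zero fun w _ => ind_of_ne (h w)

theorem prof_of_unique {v : List ℕ} {θ : OrderFormula} {w : T.Node} (hw : pos v w.1 = θ)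
    (h : ∀ w' : T.Node, pos v w'.1 = θ → w' = w) : T.prof l v θ = Profile.single (T.label w) := by
  rw [prof, Finset.sum_eq_single w]
  · simp [ind, hw]
  · intro w' _ hne
    exact ind_of_ne fun h' => hne (h w' h')
  · simp

theorem prof_cases {v : List ℕ} {θ : OrderFormula}
    (h : ∀ x y, pos v x = θ → pos v y = θ → x = y) :
    T.prof l v θ = 0 ∨ (T.prof l v θ).IsSingleton := by
  by_cases h0 : ∀ w : T.Node, pos v w.1 ≠ θ
  · exact Or.inl ((T.prof_eq_zero_iff l v θ).2 h0)
  · push Not at h0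
    obtain ⟨w, hw⟩ := h0
    right
    rw [T.prof_of_unique l hw fun w' hw' => Subtype.ext (h _ _ hw' hw)]
    exact Profile.isSingleton_single _

theorem prof_self (v : T.Node) : T.prof l v.1 .eq = Profile.single (T.label v) :=
  T.prof_of_unique l (pos_self _) fun w hw => by
    rw [pos_eq_iff (by simp)] at hw
    exact (Subtype.ext hw).symm

/-- For the last four conditions on full types: a node at a far position forces one at the adjacent
position. -/
theorem prof_zero_of_witness {v : List ℕ} {θ θ' : OrderFormula}
    (h : ∀ w : T.Node, pos v w.1 = θ' → ∃ w' : T.Node, pos v w'.1 = θ)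
    (h0 : T.prof l v θ = 0) : T.prof l v θ' = 0 := by
  rw [prof_eq_zero_iff] at h0 ⊢
  intro w hw
  obtain ⟨w', hw'⟩ := h w hw
  exact h0 w' hw'

/-- The full type of a node. -/
noncomputable def fullType (v : T.Node) : FullType P l where
  at_ := T.prof l v.1
  eq_singleton := by rw [prof_self]; exact Profile.isSingleton_single _
  right_cases := T.prof_cases l fun x y hx hy => by
    rw [pos_eq_iff (by simp)] at hx hy
    obtain ⟨u, i, h1, rfl⟩ := hx
    obtain ⟨u', i', h2, rfl⟩ := hy
    obtain ⟨rfl, h⟩ := List.append_inj' (h1.symm.trans h2) rfl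
    obtain rfl : i = i' := by simpa using h
    rfl
  up_cases := T.prof_cases l fun x y hx hy => by
    rw [pos_eq_iff (by simp)] at hx hy
    obtain ⟨i, h1⟩ := hx
    obtain ⟨i', h2⟩ := hy
    exact (List.append_inj' (h1.symm.trans h2) rfl).1
  left_cases := T.prof_cases l fun x y hx hy => by
    rw [pos_eq_iff (by simp)] at hx hy
    obtain ⟨u, i, rfl, h1⟩ := hx
    obtain ⟨u', i', rfl, h2⟩ := hy
    obtain ⟨rfl, h⟩ := List.append_inj' (h1.symm.trans h2) rfl
    obtain rfl : i = i' := by simpa using h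
    rfl
  rright_zero := T.prof_zero_of_witness l fun w hw => by
    rw [pos_eq_iff (by simp)] at hw
    obtain ⟨u, i, j, hij, h1, h2⟩ := hw
    exact ⟨⟨u ++ [i + 1], T.mem_of_le hij.le (by simp [← h2])⟩,
      (pos_eq_iff (by simp)).2 ⟨u, i, h1, rfl⟩⟩
  ddown_zero := T.prof_zero_of_witness l fun w hw => by
    rw [pos_eq_iff (by simp)] at hw
    obtain ⟨i, j, s, h⟩ := hw
    exact ⟨⟨v.1 ++ [i], T.mem_of_append (j :: s) (by simp [← h])⟩,
      (pos_eq_iff (by simp)).2 ⟨i, rfl⟩⟩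
  lleft_zero := T.prof_zero_of_witness l fun w hw => by
    rw [pos_eq_iff (by simp)] at hw
    obtain ⟨u, i, j, hij, h1, h2⟩ := hw
    obtain ⟨k, rfl⟩ : ∃ k, j = k + 1 := ⟨j - 1, by omega⟩
    exact ⟨⟨u ++ [k], T.left_mem _ _ (by simp [← h2])⟩,
      (pos_eq_iff (by simp)).2 ⟨u, k, rfl, h2⟩⟩
  uup_zero := T.prof_zero_of_witness l fun w hw => by
    rw [pos_eq_iff (by simp)] at hw
    obtain ⟨i, j, s, h⟩ := hw
    -- Dropping the last index of `v` gives its parent.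
    have h' : v.1 = (w.1 ++ i :: (j :: s).dropLast) ++ [(j :: s).getLast (by simp)] := by
      rw [h, List.append_assoc, List.cons_append, List.dropLast_append_getLast]
    exact ⟨⟨_, T.parent_mem _ _ (h' ▸ v.2)⟩, (pos_eq_iff (by simp)).2 ⟨_, h'⟩⟩

/-- The full type of a node, extended to all sequences. -/
noncomputable def typeAt (v : List ℕ) : FullType P l :=
  open Classical in
  -- Off the domain the type of the root is a mere default value.
  if h : v ∈ T.dom then T.fullType l ⟨v, h⟩ else T.fullType l ⟨[], T.root_mem⟩

variable {T} in
theorem typeAt_at {v : List ℕ} (h : v ∈ T.dom) (θ : OrderFormula) :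
    (T.typeAt l v).at_ θ = T.prof l v θ := by
  rw [typeAt, dif_pos h]; rfl

/-- The full types of the children of a node of a tree form a family. -/
theorem family_typeAt {u : List ℕ} (hu : u ∈ T.dom) {d : ℕ}
    (hd : ∀ i, u ++ [i] ∈ T.dom ↔ i < d) :
    Family (T.typeAt l u) d (fun i => T.typeAt l (u ++ [i])) := by
  have hx : ∀ (x : T.Node) j s, x.1 = u ++ j :: s → j < d := by
    intro x j s h
    exact (hd j).1 (T.mem_of_append s (by simp [← h]))
  have hb : ∀ t < d, (T.typeAt l (u ++ [t])).below = ∑ w : T.Node,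
      (ind (Profile.single (T.label w) : Profile P l) w.1 (u ++ [t]) .down +
        ind (Profile.single (T.label w)) w.1 (u ++ [t]) .ddown) := by
    intro t ht
    rw [FullType.below, typeAt_at l ((hd t).2 ht), typeAt_at l ((hd t).2 ht), prof, prof,
      Finset.sum_add_distrib]
  refine ⟨?_, ?_, ?_, ?_, ?_, ?_⟩
  -- The one-node identity is summed over all nodes, and the sum over the children is moved outside.
  · rw [typeAt_at l hu, prof, Finset.sum_congr rfl fun w _ => ind_down (hx w) _, Finset.sum_comm]
    refine Finset.sum_congr rfl fun t ht => ?_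
    rw [typeAt_at l ((hd t).2 (Finset.mem_range.1 ht)), prof]
  · rw [typeAt_at l hu, prof, Finset.sum_congr rfl fun w _ => ind_ddown (hx w) _, Finset.sum_comm]
    exact Finset.sum_congr rfl fun t ht => (hb t (Finset.mem_range.1 ht)).symm
  · intro i hi
    refine ⟨?_, ?_, ?_⟩
    · rw [typeAt_at l ((hd i).2 hi), typeAt_at l hu]
      exact Finset.sum_congr rfl fun w _ => ind_up _ i
    · rw [typeAt_at l ((hd i).2 hi), typeAt_at l hu, typeAt_at l hu, prof, prof, prof,
        ← Finset.sum_add_distrib]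
      exact Finset.sum_congr rfl fun w _ => ind_uup _ i
    · rw [FullType.aside, Finset.sum_congr rfl fun t ht => hb t
          ((Finset.mem_range.1 ht).trans hi),
        Finset.sum_congr rfl fun t ht => hb t (Finset.mem_Ico.1 ht).2,
        Finset.sum_comm, Finset.sum_comm (s := Finset.Ico (i + 1) d)]
      simp only [typeAt_at l ((hd i).2 hi), typeAt_at l hu, prof, ← Finset.sum_add_distrib]
      exact Finset.sum_congr rfl fun w _ => ind_free (hx w) _ i
  · intro h0
    rw [typeAt_at l ((hd 0).2 h0), prof_eq_zero_iff]
    exact fun w => pos_first_child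
  · intro i hi
    rw [typeAt_at l ((hd i).2 (by omega)), prof_eq_zero_iff]
    exact fun w => pos_last_child (hx w) hi
  · intro i hi
    have h1 := (hd (i + 1)).2 hi
    have h2 := (hd i).2 (by omega)
    simp only [FullType.LinksToLeft, typeAt_at l h1, typeAt_at l h2, prof,
      ← Finset.sum_add_distrib]
    exact ⟨Finset.sum_congr rfl fun w _ => ind_left _ i,
      Finset.sum_congr rfl fun w _ => ind_lleft _ i,
      Finset.sum_congr rfl fun w _ => ind_right _ i,
      Finset.sum_congr rfl fun w _ => ind_rright _ i⟩

theorem isRoot_typeAt : (T.typeAt l []).IsRoot := by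
  have h : ∀ x, pos [] x = .eq ∨ pos [] x = .down ∨ pos [] x = .ddown := by
    rintro (_ | ⟨i, _ | ⟨j, s⟩⟩) <;> simp [pos]
  refine ⟨?_, ?_, ?_, ?_⟩ <;> rw [typeAt_at l T.root_mem, prof_eq_zero_iff] <;> intro w <;>
    rcases h w.1 with h | h | h <;> simp [h]

end FinTree

/-! ### Consistency in a tree -/

section Consistency

open OrderFormula FinTree

variable {P : Type*} [Fintype P] [DecidableEq P] (φ : NormalForm P) (T : FinTree P)

omit [DecidableEq P] in
theorem prof_ne_zero_iff {m : ℕ} (l : Fin m → ℕ) (v : List ℕ) (θ : OrderFormula) (b : OneType P) :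
    T.prof l v θ b ≠ 0 ↔ ∃ w : T.Node, pos v w.1 = θ ∧ T.label w = b := by
  have hz : ∀ w : T.Node, ind (Profile.single (T.label w) : Profile P l) w.1 v θ b =
      if pos v w.1 = θ ∧ T.label w = b then 1 else 0 := by
    intro w
    by_cases h1 : pos v w.1 = θ <;> by_cases h2 : b = T.label w <;>
      simp [ind, h1, Profile.single, h2, eq_comm (a := T.label w)]
  rw [prof, Finset.sum_apply]
  simp only [hz]
  constructor
  · intro h
    obtain ⟨w, -, hw⟩ := Finset.exists_ne_zero_of_sum_ne_zero h
    exact ⟨w, by_contra fun h' => hw (if_neg h')⟩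
  · rintro ⟨w, hw⟩ h
    have := (Tuple.cut_sum Finset.univ
      (fun w : T.Node => if pos v w.1 = θ ∧ T.label w = b then (1 : Tuple l) else 0)).2
        ⟨w, Finset.mem_univ _, by rw [if_pos hw]; rfl⟩
    rw [h] at this
    simp at this

omit [DecidableEq P] in
open Classical in
theorem res_prof {m : ℕ} (l : Fin m → ℕ) (v : List ℕ) (θ : OrderFormula) (b : OneType P)
    (j : Fin m) : (T.prof l v θ b).res j =
      ∑ w : T.Node, if (pos v w.1, T.label w) = (θ, b) then 1 else 0 := by
  rw [prof, Finset.sum_apply, Tuple.res_sum]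
  refine Finset.sum_congr rfl fun w _ => ?_
  by_cases h1 : pos v w.1 = θ <;> by_cases h2 : b = T.label w <;>
    simp [ind, h1, Profile.single, h2, eq_comm (a := T.label w)]

-- After exchanging the sums, each node contributes at exactly one pair, its own position and
-- 1-type, and entailment there is the truth of `φ.psi j` at that node.
open Classical in
theorem count_mod (v : T.Node) (j : Fin φ.m) :
    (∑ q : OrderFormula × OneType P with Entails (T.label v) q.2 q.1 (φ.psi j),
        ((T.prof φ.l v.1 q.1 q.2).res j).val) % φ.l j =
      Set.ncard {w | (φ.psi j).HoldsAt T v w} % φ.l j := by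
  have : NeZero (φ.l j) := ⟨(φ.l_pos j).ne'⟩
  rw [← ZMod.natCast_eq_natCast_iff']
  push_cast
  simp only [ZMod.natCast_val, ZMod.cast_id', id, res_prof]
  rw [Finset.sum_comm, Set.ncard_eq_toFinset_card', Finset.card_eq_sum_ones]
  push_cast
  rw [Set.toFinset_ofPred, Finset.sum_filter]
  refine Finset.sum_congr rfl fun w _ => ?_
  rw [Finset.sum_ite_eq, holdsAt_iff_entails T v w (φ.psi_qf j)]
  simp

/-- Consistency of the full type of a node expresses that the node satisfies the formula. -/
theorem isConsistent_iff (v : T.Node) : (T.fullType φ.l v).IsConsistent φ ↔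
    (∀ w, φ.chi.HoldsAt T v w) ∧ (∀ i, ∃ w, (φ.chiEx i).HoldsAt T v w) ∧
      ∀ j, (φ.cmp j).Holds (Set.ncard {w | (φ.psi j).HoldsAt T v w} % φ.l j) (φ.k j) := by
  have hat : (T.fullType φ.l v).at_ = T.prof φ.l v.1 := rfl
  have ha : ∀ a, T.prof φ.l v.1 .eq a = 1 ↔ a = T.label v := by
    intro a
    rw [prof_self]
    by_cases h : a = T.label v <;> simp [Profile.single, h, Tuple.one_ne_zero.symm]
  simp only [FullType.IsConsistent, hat, ha, exists_eq_left, prof_ne_zero_iff, count_mod]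
  refine and_congr ?_ (and_congr ?_ Iff.rfl)
  · constructor
    · intro h w
      exact (holdsAt_iff_entails T v w φ.chi_qf).2 (h _ _ ⟨w, rfl, rfl⟩)
    · rintro h _ _ ⟨w, rfl, rfl⟩
      exact (holdsAt_iff_entails T v w φ.chi_qf).1 (h w)
  · refine forall_congr' fun i => ?_
    constructor
    · rintro ⟨_, _, ⟨w, rfl, rfl⟩, h⟩
      exact ⟨w, (holdsAt_iff_entails T v w (φ.chiEx_qf i)).2 h⟩
    · rintro ⟨w, h⟩
      exact ⟨_, _, ⟨w, rfl, rfl⟩, (holdsAt_iff_entails T v w (φ.chiEx_qf i)).1 h⟩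

theorem satisfiable_iff :
    φ.toFormula.Satisfiable ↔ ∃ T : FinTree P, ∀ v, (T.fullType φ.l v).IsConsistent φ := by
  refine exists_congr fun T => ?_
  simp only [φ.holds_iff, isConsistent_iff]
  -- A sentence is tested under any one assignment; the root supplies it.
  exact ⟨fun h => h fun _ => ⟨[], T.root_mem⟩, fun h _ => h⟩

end Consistency

/-! ### Trees and good types -/

open FinTree

/-! ### The 1-types determine all full types -/

section Uniqueness

variable {P : Type*} {m : ℕ} {l : Fin m → ℕ} {D : Finset (List ℕ)} {deg : List ℕ → ℕ}
  {τ τ' : List ℕ → FullType P l}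

theorem exists_length_lt (D : Finset (List ℕ)) : ∃ B, ∀ u ∈ D, u.length < B :=
  ⟨D.sup List.length + 1, fun _ hu => Nat.lt_succ_of_le (Finset.le_sup (f := List.length) hu)⟩

/-- Two assignments of full types that agree on the 1-types and form families everywhere agree
on the positions below a node. -/
theorem below_unique (hdeg : ∀ u ∈ D, ∀ i, u ++ [i] ∈ D ↔ i < deg u)
    (hτ : ∀ u ∈ D, Family (τ u) (deg u) (fun i => τ (u ++ [i])))
    (hτ' : ∀ u ∈ D, Family (τ' u) (deg u) (fun i => τ' (u ++ [i])))
    (heq : ∀ u ∈ D, (τ u).at_ .eq = (τ' u).at_ .eq) {u : List ℕ} (hu : u ∈ D) :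
    (τ u).at_ .down = (τ' u).at_ .down ∧ (τ u).at_ .ddown = (τ' u).at_ .ddown := by
  obtain ⟨B, hB⟩ := exists_length_lt D
  have hmem : ∀ u ∈ D, ∀ i ∈ Finset.range (deg u), u ++ [i] ∈ D := fun u hu i hi =>
    (hdeg u hu i).2 (Finset.mem_range.1 hi)
  have hdown : ∀ u ∈ D, (τ u).at_ .down = (τ' u).at_ .down := by
    intro u hu
    rw [(hτ u hu).down, (hτ' u hu).down]
    exact Finset.sum_congr rfl fun i hi => heq _ (hmem u hu i hi)
  refine ⟨hdown u hu, ?_⟩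
  -- Here `n` measures how far the depth is from `B`, so children are treated before their parent;
  -- `n = 0` cannot occur.
  have key : ∀ n, ∀ u ∈ D, u.length + n = B → (τ u).at_ .ddown = (τ' u).at_ .ddown := by
    intro n
    induction n with
    | zero => intro u hu h; exact absurd (hB u hu) (by omega)
    | succ n ih =>
      intro u hu h
      rw [(hτ u hu).ddown, (hτ' u hu).ddown]
      refine Finset.sum_congr rfl fun i hi => ?_
      have hi' := hmem u hu i hi
      rw [FullType.below, FullType.below, hdown _ hi', ih _ hi' (by simp; omega)]
  have := hB u hu
  exact key (B - u.length) u hu (by omega)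

/-- The family at a node determines the full types of the children from that of the node, their
1-types and the positions below them. -/
theorem Family.unique {α α' : FullType P l} {d : ℕ} {β β' : ℕ → FullType P l}
    (h : Family α d β) (h' : Family α' d β') (hα : α = α')
    (heq : ∀ i < d, (β i).at_ .eq = (β' i).at_ .eq)
    (hdown : ∀ i < d, (β i).at_ .down = (β' i).at_ .down)
    (hddown : ∀ i < d, (β i).at_ .ddown = (β' i).at_ .ddown) : ∀ i < d, β i = β' i := by
  subst hα
  have hbelow : ∀ i < d, (β i).below = (β' i).below := fun i hi => by
    rw [FullType.below, FullType.below, hdown i hi, hddown i hi]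
  have hleft : ∀ i < d, (β i).at_ .left = (β' i).at_ .left ∧
      (β i).at_ .lleft = (β' i).at_ .lleft := by
    intro i
    induction i with
    | zero =>
      intro hi
      rw [h.first hi, h'.first hi, (β 0).lleft_zero (h.first hi), (β' 0).lleft_zero (h'.first hi)]
      exact ⟨rfl, rfl⟩
    | succ i ih =>
      intro hi
      obtain ⟨h1, h2⟩ := ih (by omega)
      obtain ⟨a1, a2, -, -⟩ := h.sib i hi
      obtain ⟨b1, b2, -, -⟩ := h'.sib i hi
      exact ⟨by rw [a1, b1, heq i (by omega)], by rw [a2, b2, h1, h2]⟩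
  -- Entries to the left were propagated from the first child; those to the right start from the
  -- last one, at distance `k`.
  have hright : ∀ k i, i + k + 1 = d → (β i).at_ .right = (β' i).at_ .right ∧
      (β i).at_ .rright = (β' i).at_ .rright := by
    intro k
    induction k with
    | zero =>
      intro i hi
      have h1 := h.last i hi
      have h2 := h'.last i hi
      rw [h1, h2, (β i).rright_zero h1, (β' i).rright_zero h2]
      exact ⟨rfl, rfl⟩
    | succ k ih =>
      intro i hi
      obtain ⟨h1, h2⟩ := ih (i + 1) (by omega)
      obtain ⟨-, -, a1, a2⟩ := h.sib i (by omega)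
      obtain ⟨-, -, b1, b2⟩ := h'.sib i (by omega)
      exact ⟨by rw [a1, b1, heq (i + 1) (by omega)], by rw [a2, b2, h1, h2]⟩
  intro i hi
  obtain ⟨l1, l2⟩ := hleft i hi
  obtain ⟨r1, r2⟩ := hright (d - i - 1) i (by omega)
  obtain ⟨a1, a2, a3⟩ := h.link i hi
  obtain ⟨b1, b2, b3⟩ := h'.link i hi
  refine FullType.ext_at fun θ => ?_
  cases θ
  · exact heq i hi
  · exact hdown i hi
  · rw [a1, b1]
  · exact hddown i hi
  · rw [a2, b2]
  · exact r1
  · exact l1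
  · exact r2
  · exact l2
  · rw [a3, b3]
    congr 1
    · congr 1
      exact Finset.sum_congr rfl fun t ht => hbelow t ((Finset.mem_range.1 ht).trans hi)
    · exact Finset.sum_congr rfl fun t ht => hbelow t (Finset.mem_Ico.1 ht).2

/-- Two assignments of full types to a tree domain that start with root types, agree on the
1-types and form families everywhere are equal. -/
theorem assignment_unique (hpar : ∀ u i, u ++ [i] ∈ D → u ∈ D)
    (hdeg : ∀ u ∈ D, ∀ i, u ++ [i] ∈ D ↔ i < deg u)
    (hτ : ∀ u ∈ D, Family (τ u) (deg u) (fun i => τ (u ++ [i])))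
    (hτ' : ∀ u ∈ D, Family (τ' u) (deg u) (fun i => τ' (u ++ [i])))
    (hr : (τ []).IsRoot) (hr' : (τ' []).IsRoot)
    (heq : ∀ u ∈ D, (τ u).at_ .eq = (τ' u).at_ .eq) : ∀ u ∈ D, τ u = τ' u := by
  have hb := fun {u} hu => below_unique (u := u) hdeg hτ hτ' heq hu
  intro u
  -- Removing the last index leads from a node to its parent, so the argument descends from the
  -- root; `hb` already settles the entries below every node.
  induction u using List.reverseRecOn with
  | nil =>
    intro hu
    obtain ⟨a1, a2, a3, a4⟩ := hr
    obtain ⟨b1, b2, b3, b4⟩ := hr'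
    refine FullType.ext_at fun θ => ?_
    cases θ
    · exact heq _ hu
    · exact (hb hu).1
    · rw [a1, b1]
    · exact (hb hu).2
    · rw [(τ []).uup_zero a1, (τ' []).uup_zero b1]
    · rw [a2, b2]
    · rw [a3, b3]
    · rw [(τ []).rright_zero a2, (τ' []).rright_zero b2]
    · rw [(τ []).lleft_zero a3, (τ' []).lleft_zero b3]
    · rw [a4, b4]
  | append_singleton u i ih =>
    intro hi
    have hu := hpar u i hi
    have hmem : ∀ i < deg u, u ++ [i] ∈ D := fun i hi => (hdeg u hu i).2 hi
    exact (hτ u hu).unique (hτ' u hu) (ih hu) (fun i hi => heq _ (hmem i hi))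
      (fun i hi => (hb (hmem i hi)).1) (fun i hi => (hb (hmem i hi)).2) i ((hdeg u hu i).1 hi)

end Uniqueness

/-! ### From models to good types and back -/

section Correctness

variable {P : Type*} [Fintype P] [DecidableEq P] {φ : NormalForm P}

/-- The nodes of a model have good types. -/
theorem good_typeAt {T : FinTree P} (hT : ∀ v, (T.fullType φ.l v).IsConsistent φ) {u : List ℕ}
    (hu : u ∈ T.dom) : Good φ (T.typeAt φ.l u) := by
  obtain ⟨B, hB⟩ := exists_length_lt T.dom
  have key : ∀ n, ∀ u ∈ T.dom, u.length + n = B → Good φ (T.typeAt φ.l u) := by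
    intro n
    induction n with
    | zero => intro u hu h; exact absurd (hB u hu) (by omega)
    | succ n ih =>
      intro u hu h
      obtain ⟨d, hd⟩ := T.exists_degree ⟨u, hu⟩
      refine Good.mk _ d _ ?_ (T.family_typeAt φ.l hu hd) fun i hi => ?_
      · rw [typeAt, dif_pos hu]
        exact hT _
      · exact ih _ ((hd i).2 hi) (by simp; omega)
  have := hB u hu
  exact key (B - u.length) u hu (by omega)

/-- A good type is at the root of a finite tree domain labelled with consistent full types. -/
theorem Good.exists_assignment {α : FullType P φ.l} (h : Good φ α) :
    ∃ (D : Finset (List ℕ)) (deg : List ℕ → ℕ) (τ : List ℕ → FullType P φ.l),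
      [] ∈ D ∧ (∀ u i, u ++ [i] ∈ D ↔ u ∈ D ∧ i < deg u) ∧ τ [] = α ∧
      ∀ u ∈ D, (τ u).IsConsistent φ ∧ Family (τ u) (deg u) (fun i => τ (u ++ [i])) := by
  classical
  induction h with
  | mk α d β hc hf _ ih =>
    -- `choose!` extends the subtree data from `i < d` to all indices and needs default values.
    have : Nonempty (FullType P φ.l) := ⟨α⟩
    choose! D deg τ h1 h2 h3 h4 using ih
    have hmem : ∀ i u, i :: u ∈ insert [] ((Finset.range d).biUnion
        fun i => (D i).image (List.cons i)) ↔ i < d ∧ u ∈ D i := by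
      intro i u
      simp only [Finset.mem_insert, reduceCtorEq, false_or, Finset.mem_biUnion, Finset.mem_range,
        Finset.mem_image, List.cons.injEq]
      constructor
      · rintro ⟨j, hj, v, hv, rfl, rfl⟩; exact ⟨hj, hv⟩
      · rintro ⟨hi, hu⟩; exact ⟨i, hi, u, hu, rfl, rfl⟩
    refine ⟨insert [] ((Finset.range d).biUnion fun i => (D i).image (List.cons i)),
      fun u => match u with | [] => d | i :: u => deg i u,
      fun u => match u with | [] => α | i :: u => τ i u, by simp, ?_, rfl, ?_⟩
    · rintro (_ | ⟨j, u⟩) i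
      · rw [List.nil_append, hmem]
        simp only [Finset.mem_insert_self, true_and]
        exact ⟨fun h => h.1, fun h => ⟨h, h1 i h⟩⟩
      · rw [List.cons_append, hmem, hmem, and_assoc]
        exact and_congr_right fun hj => h2 j hj u i
    · rintro (_ | ⟨j, u⟩) hu
      · refine ⟨hc, ?_⟩
        -- Only below `d` is the top of subtree `i` the given `β i`, so the family conditions are
        -- transferred term by term within range.
        have hτ : ∀ i < d, τ i [] = β i := h3
        have hbelow : ∀ i < d, (τ i []).below = (β i).below := fun i hi => by rw [hτ i hi]
        refine ⟨?_, ?_, ?_, ?_, ?_, ?_⟩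
        · rw [hf.down]
          exact Finset.sum_congr rfl fun i hi => by rw [← hτ i (Finset.mem_range.1 hi)]; rfl
        · rw [hf.ddown]
          exact Finset.sum_congr rfl fun i hi => by rw [← hτ i (Finset.mem_range.1 hi)]; rfl
        · intro i hi
          have := hf.link i hi
          rw [← hτ i hi, ← Finset.sum_congr rfl fun t ht => hbelow t
            ((Finset.mem_range.1 ht).trans hi),
            ← Finset.sum_congr rfl fun t ht => hbelow t (Finset.mem_Ico.1 ht).2] at this
          exact this
        · intro h0
          have := hf.first h0
          rw [← hτ 0 h0] at this
          exact this
        · intro i (hi : i + 1 = d)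
          have := hf.last i hi
          rw [← hτ i (by omega)] at this
          exact this
        · intro i (hi : i + 1 < d)
          have := hf.sib i hi
          rw [← hτ i (by omega), ← hτ (i + 1) hi] at this
          exact this
      · obtain ⟨hj, hu⟩ := (hmem j u).1 hu
        exact h4 j hj u hu

/-- A good root type is realized at the root of a model. -/
theorem Good.exists_model {α : FullType P φ.l} (hr : α.IsRoot) (h : Good φ α) :
    ∃ T : FinTree P, ∀ v, (T.fullType φ.l v).IsConsistent φ := by
  obtain ⟨D, deg, τ, h1, h2, h3, h4⟩ := h.exists_assignment
  choose lab hlab _ using fun u => (τ u).eq_singleton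
  let T : FinTree P :=
    { dom := D
      root_mem := h1
      parent_mem := fun u i h => ((h2 u i).1 h).1
      left_mem := fun u i h => (h2 u i).2 ⟨((h2 u _).1 h).1, by have := ((h2 u _).1 h).2; omega⟩
      label := fun v => lab v.1 }
  have hdeg : ∀ u ∈ D, ∀ i, u ++ [i] ∈ D ↔ i < deg u := fun u hu i => by
    rw [h2, and_iff_right hu]
  refine ⟨T, fun v => ?_⟩
  -- The announced types and the true types of `T` solve the same local conditions with the same
  -- 1-types, so they coincide and consistency carries over.
  have key := assignment_unique (τ := τ) (τ' := T.typeAt φ.l) T.parent_mem hdeg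
    (fun u hu => (h4 u hu).2) (fun u hu => T.family_typeAt φ.l hu (hdeg u hu))
    (by rw [h3]; exact hr) (T.isRoot_typeAt φ.l) fun u hu => by
      rw [typeAt_at φ.l hu, (τ u).eq_singleton.eq_single (hlab u)]
      exact (T.prof_self φ.l ⟨u, hu⟩).symm
  have hv := key v.1 v.2
  rw [typeAt, dif_pos v.2] at hv
  rw [← hv]
  exact (h4 v.1 v.2).1

end Correctness

end FO2Mod

theorem mainTheorem7 {P : Type*} [Fintype P] [DecidableEq P] (φ : FO2Mod.NormalForm P) :
    FO2Mod.ProcedureAccepts φ ↔ φ.toFormula.Satisfiable := by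
  rw [FO2Mod.procedureAccepts_iff, FO2Mod.satisfiable_iff]
  constructor
  · rintro ⟨α, hr, hg⟩
    exact hg.exists_model hr
  · rintro ⟨T, hT⟩
    exact ⟨_, T.isRoot_typeAt φ.l, FO2Mod.good_typeAt hT T.root_mem⟩
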